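/- Let $\mathfrak o$ be a Dedekind domain which is not a field, $K$ its fraction field, $L/K$ an algebraic field extension (possibly infinite or inseparable), and $\mathfrak O$ the integral closure of $\mathfrak o$ in $L$. *Ideals.* Let $\mathcal F(\mathfrak O)$ be the commutative monoid, under multiplication, of fractional ideals of $\mathfrak O$ (non-zero $\mathfrak O$-submodules $I\subseteq L$ with $dI\subseteq\mathfrak O$ for some $d\in L^\times$), and let $\mathcal P(\mathfrak O)\subseteq\mathcal I(\mathfrak O)\subseteq\mathcal F(\mathfrak O)$ be the groups of principal and of invertible fractional ideals. Put $\mathrm{Cl}(\mathfrak O)=\mathcal F(\mathfrak O)/\mathcal P(\mathfrak O)$ and $\mathrm{Pic}(\mathfrak O)=\mathcal I(\mathfrak O)/\mathcal P(\mathfrak O)\subseteq\mathrm{Cl}(\mathfrak O)$, and write $[I]$ for the class of $I$. For a commutative monoid $M$ let $\mathrm{Reg}\,M=\{a\in M: a=aba\text{ for some }b\in M\}$. *Valuations.* Let $\mathrm{m\text{-}Spec}\,\mathfrak O$ be the set of maximal ideals of $\mathfrak O$ with the topology whose open base consists of the sets $\{\mathfrak P: A\subseteq\mathfrak P\}$,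 $A\subseteq\mathfrak O$ finite. For $\mathfrak P\in\mathrm{m\text{-}Spec}\,\mathfrak O$ let $v_{\mathfrak P}:L^\times\to\mathbb Q$ be the unique additive valuation with valuation ring $\mathfrak O_{\mathfrak P}$ and $v_{\mathfrak P}(K^\times)=\mathbb Z$. *Functions.* Let $\widetilde{\mathbb R}=\mathbb R\times\{0,1\}$ with the lexicographic order, the addition $(\alpha,s)+(\beta,t)=(\alpha+\beta,\max\{s,t\})$ and the involution $\iota(\alpha,s)=(-\alpha,s)$. Put $\mathrm{val}_{\mathfrak P}=\{(\alpha,0):\alpha\in v_{\mathfrak P}(L^\times)\}$, and let $\widetilde V_{\mathfrak P}=\mathrm{val}_{\mathfrak P}\cup(\mathbb R\times\{1\})$ if $v_{\mathfrak P}(L^\times)$ is dense in $\mathbb R$, and $\widetilde V_{\mathfrak P}=\mathrm{val}_{\mathfrak P}$ otherwise. Let $\mathcal S^u_{0,b}(\mathfrak O;\widetilde V)$ be the monoid, under pointwise addition, of functions $f:\mathrm{m\text{-}Spec}\,\mathfrak O\to\widetilde{\mathbb R}$ with $f(\mathfrak P)\in\widetilde V_{\mathfrak P}$ for all $\mathfrak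 P$ that are - upper semicontinuous, i.e. $\{\mathfrak P: f(\mathfrak P)<a\}$ is open for every $a\in\widetilde{\mathbb R}$, - bounded, i.e. bounded above and below in $\widetilde{\mathbb R}$, and - compactly supported, i.e. equal to $(0,0)$ outside a compact set. Let $\mathcal S^u_{0,\mathrm{ref}}(\mathfrak O;\widetilde V)$ be the submonoid of those $f$ for which $\iota\circ f$ also lies in $\mathcal S^u_{0,b}(\mathfrak O;\widetilde V)$, and let $\mathcal S^u_{0,\mathrm{ref}}(\mathfrak O;\mathrm{val})$ be the submonoid (in fact a group) of those $f\in\mathcal S^u_{0,\mathrm{ref}}(\mathfrak O;\widetilde V)$ with $f(\mathfrak P)\in\mathrm{val}_{\mathfrak P}$ for all $\mathfrak P$. *The map $\widetilde F$.* For $I\in\mathcal F(\mathfrak O)$ put $f_I(\mathfrak P)=\inf\{v_{\mathfrak P}(x):0\ne x\in I\}$, and let $\tilde f_I(\mathfrak P)=(f_I(\mathfrak P),0)$ if this infimum is attained and $\tilde f_I(\mathfrak P)=(f_I(\mathfrak P),1)$ otherwise. **Corollary.** The assignment $I\mapsto\tilde f_I$ is a monoid homomorphism $\widetilde F:\mathcal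 F(\mathfrak O)\to\mathcal S^u_{0,b}(\mathfrak O;\widetilde V)$, and it induces a monoid isomorphism $$\mathrm{Cl}(\mathfrak O)/\mathrm{Pic}(\mathfrak O)\ \xrightarrow{\ \simeq\ }\ \mathcal S^u_{0,b}(\mathfrak O;\widetilde V)/\mathcal S^u_{0,\mathrm{ref}}(\mathfrak O;\mathrm{val}),\qquad [I]\longmapsto\tilde f_I\bmod\mathcal S^u_{0,\mathrm{ref}}(\mathfrak O;\mathrm{val}).$$ Moreover, the image of $\mathrm{Reg}\,\mathrm{Cl}(\mathfrak O)/\mathrm{Pic}(\mathfrak O)$ under this isomorphism equals $\mathcal S^u_{0,\mathrm{ref}}(\mathfrak O;\widetilde V)/\mathcal S^u_{0,\mathrm{ref}}(\mathfrak O;\mathrm{val})$. -/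

import Mathlib

/-! ### The totally ordered monoid `ℝ × {0, 1}` -/

/-- The set `ℝ × {0, 1}`. -/
@[ext]
structure RTilde where
  /-- the real component -/
  re : ℝ
  /-- the component in `{0, 1}` -/
  lvl : Fin 2

namespace RTilde

/-- The lexicographic order: `(α, s) < (β, t)` iff `α < β`, or `α = β` and `s < t`. -/
noncomputable instance : LinearOrder RTilde :=
  LinearOrder.lift' (fun a => toLex (a.re, a.lvl)) (fun a b h => by
    have h' := Prod.ext_iff.1 (toLex.injective h)
    exact RTilde.ext h'.1 h'.2)

theorem lt_iff {a b : RTilde} : a < b ↔ a.re < b.re ∨ a.re = b.re ∧ a.lvl < b.lvl :=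
  Prod.Lex.toLex_lt_toLex

theorem le_iff {a b : RTilde} : a ≤ b ↔ a.re < b.re ∨ a.re = b.re ∧ a.lvl ≤ b.lvl :=
  Prod.Lex.toLex_le_toLex

/-- The sum `(α, s) + (β, t) = (α + β, max s t)`, with neutral element `(0, 0)`. -/
noncomputable instance : Add RTilde := ⟨fun a b => ⟨a.re + b.re, max a.lvl b.lvl⟩⟩

noncomputable instance : Zero RTilde := ⟨⟨0, 0⟩⟩

noncomputable instance : AddCommMonoid RTilde where
  add_assoc a b c := RTilde.ext (add_assoc _ _ _) (max_assoc _ _ _)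
  zero_add a := RTilde.ext (zero_add _) (max_eq_right (Fin.zero_le _))
  add_zero a := RTilde.ext (add_zero _) (max_eq_left (Fin.zero_le _))
  add_comm a b := RTilde.ext (add_comm _ _) (max_comm _ _)
  nsmul := nsmulRec

@[simp] theorem add_re (a b : RTilde) : (a + b).re = a.re + b.re := rfl
@[simp] theorem add_lvl (a b : RTilde) : (a + b).lvl = max a.lvl b.lvl := rfl
@[simp] theorem zero_re : (0 : RTilde).re = 0 := rfl
@[simp] theorem zero_lvl : (0 : RTilde).lvl = 0 := rfl

/-- The involution `(α, s) ↦ (-α, s)`. -/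
noncomputable def iota (a : RTilde) : RTilde := ⟨-a.re, a.lvl⟩

@[simp] theorem iota_re (a : RTilde) : a.iota.re = -a.re := rfl
@[simp] theorem iota_lvl (a : RTilde) : a.iota.lvl = a.lvl := rfl

theorem iota_add (a b : RTilde) : (a + b).iota = a.iota + b.iota :=
  RTilde.ext (by simp; ring) rfl

theorem iota_zero : (0 : RTilde).iota = 0 := RTilde.ext (by simp) rfl

protected theorem add_le_add {a b c d : RTilde} (h : a ≤ b) (h' : c ≤ d) : a + c ≤ b + d := by
  rw [le_iff] at *
  simp only [add_re, add_lvl]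
  rcases h with h | ⟨h, k⟩ <;> rcases h' with h' | ⟨h', k'⟩
  · left; linarith
  · left; linarith
  · left; linarith
  · right; exact ⟨by rw [h, h'], max_le_max k k'⟩

end RTilde

/-! ### Bounded, compactly supported, upper semicontinuous functions -/

section Functions

variable {X : Type*} [TopologicalSpace X]

theorem UpperSemicontinuous.rTilde_add {f g : X → RTilde} (hf : UpperSemicontinuous f)
    (hg : UpperSemicontinuous g) : UpperSemicontinuous (f + g) := by
  intro x c hc
  change f x + g x < c at hc
  suffices ∃ a b : RTilde, f x < a ∧ g x < b ∧ ∀ y z, y < a → z < b → y + z < c by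
    obtain ⟨a, b, ha, hb, h⟩ := this
    filter_upwards [hf x a ha, hg x b hb] with y hy hz
    exact h _ _ hy hz
  rw [RTilde.lt_iff] at hc
  simp only [RTilde.add_re, RTilde.add_lvl] at hc
  rcases hc with hc | ⟨hc, hl⟩
  · refine ⟨⟨(f x).re + (c.re - (f x).re - (g x).re) / 2, 0⟩,
      ⟨(g x).re + (c.re - (f x).re - (g x).re) / 2, 0⟩,
      RTilde.lt_iff.2 (Or.inl (by simp; linarith)), RTilde.lt_iff.2 (Or.inl (by simp; linarith)),
      fun y z hy hz => ?_⟩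
    rw [RTilde.lt_iff] at hy hz
    simp only [Fin.not_lt_zero, and_false, or_false] at hy hz
    refine RTilde.lt_iff.2 (Or.inl ?_)
    simp only [RTilde.add_re]
    linarith
  · have hl' := max_lt_iff.1 hl
    refine ⟨⟨(f x).re, c.lvl⟩, ⟨(g x).re, c.lvl⟩, RTilde.lt_iff.2 (Or.inr ⟨rfl, hl'.1⟩),
      RTilde.lt_iff.2 (Or.inr ⟨rfl, hl'.2⟩), fun y z hy hz => ?_⟩
    rw [RTilde.lt_iff] at hy hz ⊢
    simp only [RTilde.add_re, RTilde.add_lvl] at hy hz ⊢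
    rcases hy with hy | ⟨hy, ky⟩ <;> rcases hz with hz | ⟨hz, kz⟩
    · left; linarith
    · left; linarith
    · left; linarith
    · right; exact ⟨by rw [hy, hz, hc], max_lt ky kz⟩

variable (X)

/-- The monoid of bounded, compactly supported, upper semicontinuous functions `X → ℝ × {0, 1}`,
under pointwise addition. -/
def bddUSC : AddSubmonoid (X → RTilde) where
  carrier := {f | UpperSemicontinuous f ∧ (∃ Y : Set X, IsCompact Y ∧ ∀ x, x ∉ Y → f x = 0) ∧
    (∃ a, ∀ x, a ≤ f x) ∧ (∃ a, ∀ x, f x ≤ a)}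
  zero_mem' := ⟨upperSemicontinuous_const, ⟨∅, isCompact_empty, fun _ _ => rfl⟩,
    ⟨0, fun _ => le_rfl⟩, ⟨0, fun _ => le_rfl⟩⟩
  add_mem' := by
    rintro f g ⟨hf, ⟨Y, hY, hfY⟩, ⟨a, ha⟩, ⟨b, hb⟩⟩ ⟨hg, ⟨Z, hZ, hgZ⟩, ⟨c, hc⟩, ⟨d, hd⟩⟩
    refine ⟨hf.rTilde_add hg, ⟨Y ∪ Z, hY.union hZ, fun x hx => ?_⟩,
      ⟨a + c, fun x => RTilde.add_le_add (ha x) (hc x)⟩,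
      ⟨b + d, fun x => RTilde.add_le_add (hb x) (hd x)⟩⟩
    rw [Set.mem_union, not_or] at hx
    rw [Pi.add_apply, hfY x hx.1, hgZ x hx.2, add_zero]

/-- The submonoid of reflexible functions: those `f` for which both `f` and `ι ∘ f` are bounded,
compactly supported and upper semicontinuous. -/
def reflUSC : AddSubmonoid (X → RTilde) where
  carrier := {f | f ∈ bddUSC X ∧ RTilde.iota ∘ f ∈ bddUSC X}
  zero_mem' := by
    refine ⟨zero_mem _, ?_⟩
    rw [show RTilde.iota ∘ (0 : X → RTilde) = 0 from funext fun _ => RTilde.iota_zero]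
    exact zero_mem _
  add_mem' := by
    rintro f g ⟨hf, hf'⟩ ⟨hg, hg'⟩
    refine ⟨add_mem hf hg, ?_⟩
    rw [show RTilde.iota ∘ (f + g) = RTilde.iota ∘ f + RTilde.iota ∘ g from
      funext fun _ => RTilde.iota_add _ _]
    exact add_mem hf' hg'

end Functions

/-! ### Quotients of commutative monoids -/

/-- The congruence of a commutative monoid `M` modulo a submonoid `N`: `a ~ b` iff `m a = n b` for
some `m, n ∈ N`. If `N` is a group, the classes are the orbits `a N`. -/
@[to_additive /-- The congruence of an additive commutative monoid `M` modulo a submonoid `N`: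
`a ~ b` iff `m + a = n + b` for some `m, n ∈ N`. If `N` is a group, the classes are the orbits
`a + N`. -/]
def Submonoid.modCon {M : Type*} [CommMonoid M] (N : Submonoid M) : Con M where
  r a b := ∃ m ∈ N, ∃ n ∈ N, m * a = n * b
  iseqv :=
    { refl := fun _ => ⟨1, N.one_mem, 1, N.one_mem, rfl⟩
      symm := fun ⟨m, hm, n, hn, h⟩ => ⟨n, hn, m, hm, h.symm⟩
      trans := by
        rintro a b c ⟨m, hm, n, hn, h⟩ ⟨m', hm', n', hn', h'⟩
        refine ⟨m' * m, N.mul_mem hm' hm, n * n', N.mul_mem hn hn', ?_⟩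
        rw [mul_assoc, h, mul_left_comm, h', mul_assoc] }
  mul' := by
    rintro a b c d ⟨m, hm, n, hn, h⟩ ⟨m', hm', n', hn', h'⟩
    refine ⟨m * m', N.mul_mem hm hm', n * n', N.mul_mem hn hn', ?_⟩
    rw [mul_mul_mul_comm, h, h', mul_mul_mul_comm]

/-- The submonoid of von Neumann regular elements of a commutative monoid. -/
def vonNeumannRegular (M : Type*) [CommMonoid M] : Submonoid M where
  carrier := {a | ∃ b, a = a * b * a}
  one_mem' := ⟨1, by simp⟩
  mul_mem' := by
    rintro a c ⟨b, hb⟩ ⟨d, hd⟩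
    refine ⟨b * d, ?_⟩
    calc a * c = (a * b * a) * (c * d * c) := by rw [← hb, ← hd]
      _ = a * c * (b * d) * (a * c) := by ac_rfl

/-! ### The maximal spectrum with the Krull-like topology -/

/-- The set of maximal ideals of `R`, as a separate type in order not to inherit the Zariski
topology. -/
def MSpec (R : Type*) [CommRing R] : Type _ := MaximalSpectrum R

/-- The maximal ideal given by a point. -/
def MSpec.asIdeal {R : Type*} [CommRing R] (P : MSpec R) : Ideal R := MaximalSpectrum.asIdeal P

/-- The Krull-like topology, with the sets `{P | A ⊆ P}`, for `A` a finite subset of `R`, as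
open base. -/
instance MSpec.krullLike (R : Type*) [CommRing R] : TopologicalSpace (MSpec R) :=
  TopologicalSpace.generateFrom
    {U | ∃ A : Finset R, U = {P : MSpec R | (A : Set R) ⊆ (P.asIdeal : Set R)}}

theorem MSpec.isTopologicalBasis (R : Type*) [CommRing R] :
    TopologicalSpace.IsTopologicalBasis
      {U | ∃ A : Finset R, U = {P : MSpec R | (A : Set R) ⊆ (P.asIdeal : Set R)}} where
  exists_subset_inter := by
    classical
    rintro _ ⟨A, rfl⟩ _ ⟨B, rfl⟩ P ⟨hA, hB⟩
    refine ⟨_, ⟨A ∪ B, rfl⟩, ?_, fun Q hQ => ?_⟩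
    · change ((A ∪ B : Finset R) : Set R) ⊆ _
      rw [Finset.coe_union]
      exact Set.union_subset hA hB
    · change ((A ∪ B : Finset R) : Set R) ⊆ _ at hQ
      rw [Finset.coe_union] at hQ
      exact Set.union_subset_iff.1 hQ
  sUnion_eq := Set.eq_univ_of_forall fun P => ⟨_, ⟨∅, rfl⟩, by simp⟩
  eq_generateFrom := rfl

/-! ### Additive valuations on the integral closure

Here `K` is the fraction field of `o`, `L` is an algebraic extension of `K`, and the ring under
study is the integral closure of `o` in `L`. -/

section Valuation

open IsDedekindDomain

variable (o K : Type*) {L : Type*} [CommRing o] [Field K]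
  [Field L] [Algebra K L] [Algebra o L]

/-- `v` is the normalized additive valuation of `L` corresponding to the maximal ideal `P`: its
valuation ring is the localization at `P`, and it maps `Kˣ` onto `ℤ`. -/
structure IsNormalizedAt (P : MSpec (integralClosure o L)) (v : AddValuation L (WithTop ℚ)) :
    Prop where
  integers : ∀ x : L, 0 ≤ v x ↔
    ∃ a s : integralClosure o L, s ∉ P.asIdeal ∧ (s : L) * x = (a : L)
  normalized : Set.range (fun c : Kˣ => v (algebraMap K L c)) =
    Set.range (fun n : ℤ => (((n : ℚ)) : WithTop ℚ))

theorem exists_zpow_of_torsion {L : Type*} [Field L] {Γ : Type*} [LinearOrderedCommGroupWithZero Γ]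
    (w : Valuation L Γ) (t : Γ) (h0 : t ≠ 0) (h1 : t < 1)
    (htors : ∀ x : L, x ≠ 0 → ∃ n : ℕ, 0 < n ∧ ∃ m : ℤ, w x ^ n = t ^ m) :
    ∃ v : AddValuation L (WithTop ℚ),
      ∀ (x : L), x ≠ 0 → ∀ (n : ℕ) (m : ℤ), 0 < n → w x ^ n = t ^ m → v x = ((m / n : ℚ) : WithTop ℚ) := by
  classical
  have hinj : ∀ a b : ℤ, t ^ a ≤ t ^ b → b ≤ a := by
    intro a b hab
    exact (zpow_le_zpow_iff_right_of_lt_one₀ (zero_lt_iff.2 h0) h1).1 hab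
  choose! N hN M hM using htors
  let q : L → WithTop ℚ := fun x => if x = 0 then ⊤ else ((M x / N x : ℚ) : WithTop ℚ)
  have key : ∀ x : L, x ≠ 0 → ∀ (n : ℕ) (m : ℤ), 0 < n → w x ^ n = t ^ m →
      q x = ((m / n : ℚ) : WithTop ℚ) := by
    intro x hx n m hn h
    have e : t ^ (M x * n) = t ^ (m * N x) := by
      rw [zpow_mul, zpow_mul, ← hM x hx, ← h]
      simp only [zpow_natCast, ← pow_mul, mul_comm]
    have e' : M x * n = m * N x := le_antisymm (hinj _ _ e.ge) (hinj _ _ e.le)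
    have hNx : ((N x : ℕ) : ℚ) ≠ 0 := by exact_mod_cast (hN x hx).ne'
    have hn' : (n : ℚ) ≠ 0 := by exact_mod_cast hn.ne'
    simp only [q, if_neg hx]
    congr 1
    rw [div_eq_div_iff hNx hn']
    exact_mod_cast e'
  have anti : ∀ x y : L, w x ≤ w y → q y ≤ q x := by
    intro x y hxy
    by_cases hx : x = 0
    · simp [q, hx]
    have hy : y ≠ 0 := by
      rintro rfl
      rw [map_zero, le_zero_iff, map_eq_zero] at hxy
      exact hx hxy
    simp only [q, if_neg hx, if_neg hy]
    rw [WithTop.coe_le_coe]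
    have hNx : (0 : ℚ) < N x := by exact_mod_cast hN x hx
    have hNy : (0 : ℚ) < N y := by exact_mod_cast hN y hy
    rw [div_le_div_iff₀ hNy hNx]
    have e : t ^ (M x * N y) ≤ t ^ (M y * N x) := by
      rw [zpow_mul, zpow_mul, ← hM x hx, ← hM y hy]
      simp only [zpow_natCast, ← pow_mul]
      rw [mul_comm (N y)]
      exact pow_le_pow_left₀ zero_le hxy _
    exact_mod_cast hinj _ _ e
  refine ⟨AddValuation.of q (by simp [q]) ?_ ?_ ?_, key⟩
  · simpa using key 1 one_ne_zero 1 0 one_pos (by simp)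
  · intro x y
    rcases le_max_iff.1 (w.map_add x y) with h | h
    · exact (min_le_left _ _).trans (anti _ _ h)
    · exact (min_le_right _ _).trans (anti _ _ h)
  · intro x y
    by_cases hx : x = 0
    · simp [q, hx]
    by_cases hy : y = 0
    · simp [q, hy]
    have hNx : ((N x : ℕ) : ℚ) ≠ 0 := by exact_mod_cast (hN x hx).ne'
    have hNy : ((N y : ℕ) : ℚ) ≠ 0 := by exact_mod_cast (hN y hy).ne'
    rw [key (x * y) (mul_ne_zero hx hy) (N x * N y) (M x * N y + M y * N x)
      (Nat.mul_pos (hN x hx) (hN y hy))]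
    · simp only [q, if_neg hx, if_neg hy, ← WithTop.coe_add]
      congr 1
      push_cast
      field_simp
    · rw [map_mul, mul_pow, zpow_add₀ h0, zpow_mul, zpow_mul, ← hM x hx, ← hM y hy]
      simp only [zpow_natCast, ← pow_mul]
      rw [mul_comm (N y)]

theorem exists_pow_eq_of_isAlgebraic (K : Type*) {L : Type*} [Field K] [Field L] [Algebra K L] [Algebra.IsAlgebraic K L] {Γ : Type*} [LinearOrderedCommGroupWithZero Γ]
    (w : Valuation L Γ) (x : L) (hx : x ≠ 0) :
    ∃ n : ℕ, 0 < n ∧ ∃ c : K, c ≠ 0 ∧ w x ^ n = w (algebraMap K L c) := by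
  classical
  obtain ⟨f, hf0, hf⟩ := Algebra.IsAlgebraic.isAlgebraic (R := K) x
  by_contra! H
  have hne : f.support.Nonempty := by simpa using hf0
  obtain ⟨j, hj, hmax⟩ := f.support.exists_max_image
    (fun i => w (algebraMap K L (f.coeff i) * x ^ i)) hne
  have hcoef : ∀ i ∈ f.support, algebraMap K L (f.coeff i) ≠ 0 := by
    intro i hi
    simpa using hi
  have hterm : ∀ i ∈ f.support, w (algebraMap K L (f.coeff i) * x ^ i) ≠ 0 := by
    intro i hi
    rw [Valuation.ne_zero_iff]
    exact mul_ne_zero (hcoef i hi) (pow_ne_zero _ hx)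
  have hdist : ∀ a b : ℕ, a ∈ f.support → b ∈ f.support → a < b →
      w (algebraMap K L (f.coeff a) * x ^ a) ≠ w (algebraMap K L (f.coeff b) * x ^ b) := by
    intro a b ha hb hab e
    refine H (b - a) (Nat.sub_pos_of_lt hab) (f.coeff a / f.coeff b)
      (div_ne_zero (by simpa using ha) (by simpa using hb)) ?_
    rw [map_div₀, map_div₀, eq_div_iff (by rw [Valuation.ne_zero_iff]; exact hcoef b hb)]
    have hxa : w x ^ a ≠ 0 := pow_ne_zero _ (by rwa [Valuation.ne_zero_iff])
    apply mul_right_cancel₀ hxa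
    rw [map_mul, map_mul, map_pow, map_pow] at e
    rw [e, mul_right_comm, ← pow_add, Nat.sub_add_cancel hab.le, mul_comm]
  have hs := w.map_sum_eq_of_lt (s := f.support)
    (f := fun i => algebraMap K L (f.coeff i) * x ^ i) hj (by
      intro i hi
      simp only [Finset.mem_sdiff, Finset.mem_singleton] at hi
      refine lt_of_le_of_ne (hmax i hi.1) ?_
      rcases lt_or_gt_of_ne hi.2 with h | h
      · exact hdist _ _ hi.1 hj h
      · exact (hdist _ _ hj hi.1 h).symm)
  apply hterm j hj
  rw [← hs]
  rw [Polynomial.aeval_eq_sum_range] at hf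
  have : ∑ i ∈ f.support, algebraMap K L (f.coeff i) * x ^ i = 0 := by
    rw [← hf]
    rw [Finset.sum_subset (Polynomial.supp_subset_range_natDegree_succ)]
    · simp [Algebra.smul_def]
    · intro i _ hi
      simp [Polynomial.notMem_support_iff.1 hi]
  rw [this, map_zero]

theorem mem_localization_of_aeval_eq_zero {o L : Type*} [CommRing o] [Field L] [Algebra o L]
    (P : Ideal (integralClosure o L)) [P.IsPrime] {Γ : Type*} [LinearOrderedCommGroupWithZero Γ]
    (w : Valuation L Γ) (hlt : ∀ a : integralClosure o L, a ∈ P → w (a : L) < 1)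
    (hone : ∀ a : integralClosure o L, a ∉ P → w (a : L) = 1) (x : L) (hx : w x ≤ 1) (n : ℕ) :
    ∀ f : Polynomial (integralClosure o L), f.natDegree ≤ n → Polynomial.aeval x f = 0 →
      (∃ i, f.coeff i ∉ P) →
      ∃ a s : integralClosure o L, s ∉ P ∧ (s : L) * x = (a : L) := by
  induction n with
  | zero =>
    intro f hf h0 hi
    obtain ⟨i, hi⟩ := hi
    rw [Polynomial.eq_C_of_natDegree_le_zero hf] at h0 hi
    rw [Polynomial.aeval_C] at h0
    have h1 : f.coeff 0 = 0 := Subtype.ext h0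
    rw [h1] at hi
    simp at hi
  | succ n ih =>
    intro f hf h0 hi
    rcases Nat.lt_or_ge f.natDegree (n + 1) with hlt' | hge
    · exact ih f (Nat.lt_succ_iff.1 hlt') h0 hi
    have hd : f.natDegree = n + 1 := le_antisymm hf hge
    have hb : IsIntegral o (((f.leadingCoeff : integralClosure o L) : L) * x) := by
      have := isIntegral_leadingCoeff_smul f x h0
      exact isIntegral_trans _ this
    set b : integralClosure o L := ⟨_, hb⟩ with hbdef
    have hbx : (b : L) = (f.leadingCoeff : L) * x := rfl
    by_cases hlc : f.leadingCoeff ∈ P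
    swap
    · exact ⟨b, f.leadingCoeff, hlc, rfl⟩
    have hbP : b ∈ P := by
      by_contra hbP
      have h1 := hone b hbP
      rw [hbx, map_mul] at h1
      have h2 := mul_lt_one_of_lt_of_le (hlt _ hlc) hx
      exact h2.ne h1
    refine ih (f.eraseLead + Polynomial.monomial n b) ?_ ?_ ?_
    · refine (Polynomial.natDegree_add_le _ _).trans (max_le ?_ (Polynomial.natDegree_monomial_le _))
      exact f.eraseLead_natDegree_le.trans (by omega)
    · have e := f.eraseLead_add_monomial_natDegree_leadingCoeff
      have h1 : Polynomial.aeval x f.eraseLead + (f.leadingCoeff : L) * x ^ (n + 1) = 0 := by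
        rw [← h0]
        conv_rhs => rw [← e]
        rw [map_add, Polynomial.aeval_monomial, hd]
        rfl
      rw [map_add, Polynomial.aeval_monomial, ← h1]
      change _ + (b : L) * _ = _
      rw [hbx]
      ring
    · obtain ⟨i, hi⟩ := hi
      refine ⟨i, fun h => hi ?_⟩
      by_cases hin : i = f.natDegree
      · rw [hin]; exact hlc
      rw [Polynomial.coeff_add, Polynomial.eraseLead_coeff_of_ne _ hin,
        Polynomial.coeff_monomial] at h
      refine (P.add_mem_iff_left ?_).1 h
      split_ifs
      · exact hbP
      · exact P.zero_mem

theorem exists_isNormalizedAt [Algebra o K] [IsDedekindDomain o] [IsFractionRing o K] [IsScalarTower o K L]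
    [Algebra.IsAlgebraic K L] (ho : ¬ IsField o) (P : MSpec (integralClosure o L)) :
    ∃ v : AddValuation L (WithTop ℚ), IsNormalizedAt o K P v := by
  classical
  have hPm : P.asIdeal.IsMaximal := MaximalSpectrum.isMaximal P
  -- a valuation ring dominating the localization at `P`
  obtain ⟨A, hA, hPA⟩ := Ideal.image_subset_nonunits_valuationSubring
    (A := (integralClosure o L).toSubring) P.asIdeal hPm.ne_top
  have hle : ∀ x : integralClosure o L, A.valuation (x : L) ≤ 1 := fun x =>
    (A.valuation_le_one_iff _).2 (hA x.2)
  have hmem : ∀ x : integralClosure o L, x ∈ P.asIdeal → A.valuation (x : L) < 1 := fun x hx =>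
    A.mem_nonunits_iff.1 (hPA ⟨x, hx, rfl⟩)
  have hnot : ∀ x : integralClosure o L, x ∉ P.asIdeal → A.valuation (x : L) = 1 := by
    intro x hx
    obtain ⟨y, hy⟩ := hPm.exists_inv hx
    have h1 : A.valuation (((y * x - 1 : integralClosure o L)) : L) < 1 := by
      apply hmem
      obtain ⟨i, hi, e⟩ := hy
      have : y * x - 1 = -i := by rw [← e]; ring
      rw [this]
      exact P.asIdeal.neg_mem hi
    have h2 : A.valuation ((y : L) * (x : L)) = 1 := by
      have e : ((y : L) * (x : L)) = 1 + (((y * x - 1 : integralClosure o L)) : L) := by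
        push_cast; ring
      rw [e, Valuation.map_add_eq_of_lt_left _ (by simpa using h1), map_one]
    rw [map_mul] at h2
    refine le_antisymm (hle x) ?_
    rw [← h2]
    exact mul_le_of_le_one_left' (hle y)
  -- the prime below
  have hpm : (P.asIdeal.comap (algebraMap o (integralClosure o L))).IsMaximal :=
    Ideal.isMaximal_comap_of_isIntegral_of_isMaximal P.asIdeal
  let p : HeightOneSpectrum o := ⟨P.asIdeal.comap (algebraMap o (integralClosure o L)),
    hpm.isPrime, fun h => ho (Ring.isField_iff_maximal_bot.2 (h ▸ hpm))⟩
  have hoK : ∀ a : o, algebraMap K L (algebraMap o K a) =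
      ((algebraMap o (integralClosure o L) a : integralClosure o L) : L) := by
    intro a
    rw [← IsScalarTower.algebraMap_apply o K L]
    rfl
  have hw1 : ∀ a : o, a ∉ p.asIdeal → A.valuation (algebraMap K L (algebraMap o K a)) = 1 := by
    intro a ha
    rw [hoK]
    exact hnot _ ha
  have hwlt : ∀ a : o, a ∈ p.asIdeal → A.valuation (algebraMap K L (algebraMap o K a)) < 1 := by
    intro a ha
    rw [hoK]
    exact hmem _ ha
  have hc1 : ∀ c : K, p.valuation K c = 1 → A.valuation (algebraMap K L c) = 1 := by
    intro c hc
    obtain ⟨n, d, h⟩ := p.exists_primeCompl_mul_eq_of_integer c hc.le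
    have hd : (d : o) ∉ p.asIdeal := d.2
    have hn : n ∉ p.asIdeal := by
      rw [← HeightOneSpectrum.valuation_eq_one_iff_notMem (K := K)]
      rw [← h, map_mul, hc, one_mul]
      exact (HeightOneSpectrum.valuation_eq_one_iff_notMem p).2 hd
    have := hw1 n hn
    rwa [← h, map_mul, map_mul, hw1 d hd, mul_one] at this
  obtain ⟨π, hπ'⟩ := p.valuation_exists_uniformizer' K
  have hπ : p.valuation K (algebraMap o K π) = WithZero.exp (-1) := hπ'
  have hπp : π ∈ p.asIdeal := by
    rw [← HeightOneSpectrum.valuation_lt_one_iff_mem (K := K)]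
    change p.valuation K (algebraMap o K π) < 1
    rw [hπ]
    rw [← WithZero.exp_zero, WithZero.exp_lt_exp]
    norm_num
  set t := A.valuation (algebraMap K L (algebraMap o K π)) with ht
  have ht1 : t < 1 := hwlt π hπp
  have hπ0 : algebraMap o K π ≠ 0 := by
    intro h
    rw [h, map_zero] at hπ
    exact WithZero.exp_ne_zero hπ.symm
  have ht0 : t ≠ 0 := by
    rw [ht, Valuation.ne_zero_iff]
    simpa using hπ0
  have hcz : ∀ c : K, c ≠ 0 → ∃ m : ℤ, A.valuation (algebraMap K L c) = t ^ m := by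
    intro c hc
    have hc' : p.valuation K c ≠ 0 := by rwa [Valuation.ne_zero_iff]
    refine ⟨-WithZero.log (p.valuation K c), ?_⟩
    have h1 := hc1 (c * (algebraMap o K π) ^ (WithZero.log (p.valuation K c))) (by
      rw [map_mul, map_zpow₀, hπ, ← WithZero.exp_zsmul]
      nth_rewrite 1 [← WithZero.exp_log hc']
      rw [← WithZero.exp_add]
      simp)
    rw [map_mul, map_mul, map_zpow₀, map_zpow₀, ← ht] at h1
    rw [zpow_neg]
    exact eq_inv_of_mul_eq_one_left h1
  obtain ⟨v, hv⟩ := exists_zpow_of_torsion A.valuation t ht0 ht1 (by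
    intro x hx
    obtain ⟨n, hn, c, hc, e⟩ := exists_pow_eq_of_isAlgebraic K A.valuation x hx
    obtain ⟨m, hm⟩ := hcz c hc
    exact ⟨n, hn, m, e.trans hm⟩)
  have hval : ∀ x : L, x ≠ 0 → ∃ n : ℕ, 0 < n ∧ ∃ m : ℤ, A.valuation x ^ n = t ^ m ∧
      v x = ((m / n : ℚ) : WithTop ℚ) := by
    intro x hx
    obtain ⟨n, hn, c, hc, e⟩ := exists_pow_eq_of_isAlgebraic K A.valuation x hx
    obtain ⟨m, hm⟩ := hcz c hc
    exact ⟨n, hn, m, e.trans hm, hv x hx n m hn (e.trans hm)⟩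
  have hnonneg : ∀ x : L, 0 ≤ v x ↔ A.valuation x ≤ 1 := by
    intro x
    by_cases hx : x = 0
    · simp [hx]
    obtain ⟨n, hn, m, e, hvx⟩ := hval x hx
    rw [hvx, ← pow_le_one_iff_of_nonneg zero_le hn.ne', e, ← WithTop.coe_zero,
      WithTop.coe_le_coe, ← zpow_zero t,
      zpow_le_zpow_iff_right_of_lt_one₀ (zero_lt_iff.2 ht0) ht1]
    have hn' : (0 : ℚ) < n := by exact_mod_cast hn
    rw [le_div_iff₀ hn', zero_mul]
    exact_mod_cast Iff.rfl
  refine ⟨v, ⟨fun x => (hnonneg x).trans ⟨fun hx => ?_, ?_⟩, ?_⟩⟩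
  · -- an element of the valuation ring is a fraction with denominator outside `P`
    obtain ⟨f, hf0, hf⟩ := Algebra.IsAlgebraic.isAlgebraic (R := K) x
    obtain ⟨j, hj, hmax⟩ := f.support.exists_max_image
      (fun i => p.valuation K (f.coeff i)) (by simpa using hf0)
    have hfj : f.coeff j ≠ 0 := by simpa using hj
    have hfjv : p.valuation K (f.coeff j) ≠ 0 := by rwa [Valuation.ne_zero_iff]
    have hci : ∀ i, p.valuation K (f.coeff i / f.coeff j) ≤ 1 := by
      intro i
      by_cases hi : i ∈ f.support
      · rw [map_div₀]
        exact div_le_one_of_le₀ (hmax i hi) zero_le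
      · simp [Polynomial.notMem_support_iff.1 hi]
    choose N d hNd using fun i => p.exists_primeCompl_mul_eq_of_integer _ (hci i)
    have hN : ∀ i ∈ f.support, ∃ M : o, algebraMap o K M =
        (f.coeff i / f.coeff j) * algebraMap o K (∏ k ∈ f.support, (d k : o)) := by
      intro i hi
      refine ⟨N i * ∏ k ∈ f.support.erase i, (d k : o), ?_⟩
      rw [← Finset.mul_prod_erase _ _ hi, map_mul, map_mul, ← hNd]
      ring
    choose! M hM using hN
    have hD : (∏ k ∈ f.support, (d k : o)) ∉ p.asIdeal :=
      prod_mem (S := p.asIdeal.primeCompl) fun k _ => (d k).2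
    let g : Polynomial (integralClosure o L) :=
      ∑ i ∈ f.support, Polynomial.monomial i (algebraMap o (integralClosure o L) (M i))
    refine mem_localization_of_aeval_eq_zero P.asIdeal A.valuation hmem hnot x hx _ g le_rfl ?_
      ⟨j, ?_⟩
    · rw [map_sum]
      have : ∀ i ∈ f.support, Polynomial.aeval x (Polynomial.monomial i
          (algebraMap o (integralClosure o L) (M i))) =
          algebraMap K L (algebraMap o K (∏ k ∈ f.support, (d k : o)) / f.coeff j) *
            (algebraMap K L (f.coeff i) * x ^ i) := by
        intro i hi
        rw [Polynomial.aeval_monomial]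
        change ((algebraMap o (integralClosure o L) (M i) : integralClosure o L) : L) * _ = _
        rw [← hoK, hM i hi, ← mul_assoc, ← map_mul]
        congr 2
        ring
      rw [Finset.sum_congr rfl this, ← Finset.mul_sum]
      rw [Polynomial.aeval_def, Polynomial.eval₂_eq_sum, Polynomial.sum_def] at hf
      rw [hf, mul_zero]
    · have hg : g.coeff j = algebraMap o (integralClosure o L) (M j) := by
        simp only [g, Polynomial.finsetSum_coeff, Polynomial.coeff_monomial]
        rw [Finset.sum_ite_eq' f.support j, if_pos hj]
      rw [hg]
      intro h
      apply hD
      have e := hM j hj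
      rw [div_self hfj, one_mul] at e
      rw [← IsFractionRing.injective o K e]
      exact h
  · rintro ⟨a, s, hs, e⟩
    have h1 : A.valuation ((s : L) * x) ≤ 1 := e ▸ hle a
    rwa [map_mul, hnot s hs, one_mul] at h1
  · have hvm : ∀ x : L, x ≠ 0 → ∀ m : ℤ, A.valuation x = t ^ m → v x = ((m : ℚ) : WithTop ℚ) := by
      intro x hx m e
      have := hv x hx 1 m one_pos (by rw [pow_one, e])
      simpa using this
    ext q
    constructor
    · rintro ⟨c, rfl⟩
      obtain ⟨m, hm⟩ := hcz c c.ne_zero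
      exact ⟨m, (hvm _ (by simp) m hm).symm⟩
    · rintro ⟨m, rfl⟩
      refine ⟨(Units.mk0 _ hπ0) ^ m, hvm _ ?_ m ?_⟩
      · simpa using zpow_ne_zero m (by simpa using hπ0)
      · simp [ht]

/-- The restriction to `Lˣ` of an additive valuation with values in `ℚ ∪ {∞}`. -/
def AddValuation.onUnits {L : Type*} [Field L] (v : AddValuation L (WithTop ℚ)) (x : Lˣ) : ℚ :=
  (v x).untopD 0

section onUnits

variable {L : Type*} [Field L] (v : AddValuation L (WithTop ℚ))

theorem AddValuation.coe_onUnits (x : Lˣ) : ((v.onUnits x : ℚ) : WithTop ℚ) = v x := by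
  have h : v x ≠ ⊤ := (v.ne_top_iff).2 x.ne_zero
  obtain ⟨q, hq⟩ := WithTop.ne_top_iff_exists.1 h
  rw [AddValuation.onUnits, ← hq]
  rfl

theorem AddValuation.onUnits_mul (x y : Lˣ) : v.onUnits (x * y) = v.onUnits x + v.onUnits y := by
  rw [← WithTop.coe_inj, WithTop.coe_add]
  simp only [AddValuation.coe_onUnits, Units.val_mul, map_mul]

theorem AddValuation.onUnits_one : v.onUnits 1 = 0 := by
  rw [← WithTop.coe_inj]
  simp [AddValuation.coe_onUnits]

theorem AddValuation.onUnits_inv (x : Lˣ) : v.onUnits x⁻¹ = -v.onUnits x := by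
  have h := v.onUnits_mul x⁻¹ x
  rw [inv_mul_cancel, v.onUnits_one] at h
  linarith

theorem AddValuation.onUnits_pow (x : Lˣ) (n : ℕ) : v.onUnits (x ^ n) = n * v.onUnits x := by
  induction n with
  | zero => simp [v.onUnits_one]
  | succ n ih => rw [pow_succ, v.onUnits_mul, ih]; push_cast; ring

theorem AddValuation.onUnits_zpow (x : Lˣ) (n : ℤ) : v.onUnits (x ^ n) = n * v.onUnits x := by
  cases n with
  | ofNat n => simpa using v.onUnits_pow x n
  | negSucc n => rw [zpow_negSucc, v.onUnits_inv, v.onUnits_pow]; push_cast; ring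

end onUnits

theorem IsNormalizedAt.unique {P : MSpec (integralClosure o L)}
    {v v' : AddValuation L (WithTop ℚ)} (h : IsNormalizedAt o K P v)
    (h' : IsNormalizedAt o K P v') : v = v' := by
  have hnn : ∀ x : Lˣ, 0 ≤ v.onUnits x ↔ 0 ≤ v'.onUnits x := by
    intro x
    rw [← WithTop.coe_nonneg (a := v.onUnits x), ← WithTop.coe_nonneg (a := v'.onUnits x),
      v.coe_onUnits, v'.coe_onUnits]
    exact (h.integers x).trans (h'.integers x).symm
  have hz : ∀ x : Lˣ, v.onUnits x = 0 → v'.onUnits x = 0 := by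
    intro x hx
    have h1 := (hnn x).1 hx.ge
    have h2 := (hnn x⁻¹).1 (by rw [v.onUnits_inv, hx, neg_zero])
    rw [v'.onUnits_inv] at h2
    linarith
  let j : Kˣ → Lˣ := fun c => Units.map (algebraMap K L).toMonoidHom c
  have hint : ∀ {u : AddValuation L (WithTop ℚ)}, IsNormalizedAt o K P u →
      (∀ c : Kˣ, ∃ n : ℤ, u.onUnits (j c) = n) ∧ ∀ n : ℤ, ∃ c : Kˣ, u.onUnits (j c) = n := by
    intro u hu
    constructor
    · intro c
      have hc : u (algebraMap K L c) ∈ Set.range (fun n : ℤ => (((n : ℚ)) : WithTop ℚ)) :=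
        hu.normalized ▸ ⟨c, rfl⟩
      obtain ⟨n, hn⟩ := hc
      refine ⟨n, ?_⟩
      rw [← WithTop.coe_inj, u.coe_onUnits]
      exact hn.symm
    · intro n
      have hc : ((n : ℚ) : WithTop ℚ) ∈ Set.range (fun c : Kˣ => u (algebraMap K L c)) :=
        hu.normalized ▸ ⟨n, rfl⟩
      obtain ⟨c, hc⟩ := hc
      refine ⟨c, ?_⟩
      rw [← WithTop.coe_inj, u.coe_onUnits]
      exact hc
  obtain ⟨π, hπ⟩ := (hint h).2 1
  obtain ⟨k, hk⟩ := (hint h').1 π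
  -- on units, `v'` is `k` times `v`
  have hmul : ∀ x : Lˣ, v'.onUnits x = k * v.onUnits x := by
    intro x
    have h1 := hz (x ^ (v.onUnits x).den * j π ^ (-(v.onUnits x).num)) (by
      rw [v.onUnits_mul, v.onUnits_pow, v.onUnits_zpow, hπ]
      have := Rat.den_mul_eq_num (v.onUnits x)
      push_cast
      linarith)
    rw [v'.onUnits_mul, v'.onUnits_pow, v'.onUnits_zpow, hk] at h1
    have hd : ((v.onUnits x).den : ℚ) ≠ 0 := by exact_mod_cast (v.onUnits x).den_nz
    have := Rat.den_mul_eq_num (v.onUnits x)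
    apply mul_left_cancel₀ hd
    push_cast at h1
    linear_combination h1 - k * this
  obtain ⟨c, hc⟩ := (hint h').2 1
  obtain ⟨m, hm⟩ := (hint h).1 c
  have hkm : k * m = 1 := by
    have := hmul (j c)
    rw [hc, hm] at this
    exact_mod_cast this.symm
  have hk0 : 0 ≤ k := by
    have := (hnn (j π)).1 (by rw [hπ]; norm_num)
    rw [hk] at this
    exact_mod_cast this
  have hk1 : k = 1 := by
    rcases Int.isUnit_iff.1 (IsUnit.of_mul_eq_one _ hkm) with e | e <;> omega
  refine AddValuation.ext fun x => ?_
  by_cases hx : x = 0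
  · simp [hx]
  · have := hmul (Units.mk0 x hx)
    rw [hk1, Int.cast_one, one_mul] at this
    have e := v.coe_onUnits (Units.mk0 x hx)
    have e' := v'.coe_onUnits (Units.mk0 x hx)
    rw [this] at e'
    exact e.symm.trans e'

instance {L : Type*} [Field L] : Nonempty (AddValuation L (WithTop ℚ)) := by
  classical
  refine ⟨AddValuation.of (fun x => if x = 0 then ⊤ else 0) (by simp) (by simp) ?_ ?_⟩
  · intro x y
    by_cases hx : x = 0 <;> by_cases hy : y = 0 <;> simp [hx, hy]
    split_ifs <;> simp
  · intro x y
    by_cases hx : x = 0 <;> by_cases hy : y = 0 <;> simp [hx, hy]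

/-- The normalized additive valuation of `L` corresponding to `P`. It exists and is unique when `o`
is a Dedekind domain which is not a field, `K` is its fraction field and `L / K` is algebraic. -/
noncomputable def normVal (P : MSpec (integralClosure o L)) : AddValuation L (WithTop ℚ) :=
  Classical.epsilon (IsNormalizedAt o K P)

theorem normVal_spec [Algebra o K] [IsDedekindDomain o] [IsFractionRing o K] [IsScalarTower o K L]
    [Algebra.IsAlgebraic K L] (ho : ¬ IsField o) (P : MSpec (integralClosure o L)) :
    IsNormalizedAt o K P (normVal o K P) :=
  Classical.epsilon_spec (exists_isNormalizedAt o K ho P)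

/-- The normalized valuation `v_P : Lˣ → ℚ`. -/
noncomputable def ord (P : MSpec (integralClosure o L)) (x : Lˣ) : ℚ := (normVal o K P).onUnits x

/-- The submonoid `val_P = {(α, 0) | α ∈ v_P(Lˣ)}` of `ℝ × {0, 1}`. -/
def valAt (P : MSpec (integralClosure o L)) : AddSubmonoid RTilde where
  carrier := {a | (∃ x : Lˣ, a.re = (ord o K P x : ℝ)) ∧ a.lvl = 0}
  zero_mem' := ⟨⟨1, by simp [ord, AddValuation.onUnits_one]⟩, rfl⟩
  add_mem' := by
    rintro a b ⟨⟨x, hx⟩, ha⟩ ⟨⟨y, hy⟩, hb⟩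
    refine ⟨⟨x * y, ?_⟩, ?_⟩
    · rw [RTilde.add_re, hx, hy, ord, ord, ord, AddValuation.onUnits_mul, Rat.cast_add]
    · rw [RTilde.add_lvl, ha, hb, max_self]

/-- The closure `V_P` of `v_P(Lˣ)` in `ℝ`. -/
def valClosure (P : MSpec (integralClosure o L)) : Set ℝ :=
  closure (Set.range fun x : Lˣ => (ord o K P x : ℝ))

/-- The submonoid `Ṽ_P` of `ℝ × {0, 1}` which is `{(α, 0) | α ∈ v_P(Lˣ)} ∪ {(β, 1) | β ∈ ℝ}` if
`V_P = ℝ`, and `{(α, 0) | α ∈ v_P(Lˣ)}` otherwise. -/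
def vTildeAt (P : MSpec (integralClosure o L)) : AddSubmonoid RTilde where
  carrier := {a | a ∈ valAt o K P ∨ (valClosure o K P = Set.univ ∧ a.lvl = 1)}
  zero_mem' := Or.inl (zero_mem _)
  add_mem' := by
    have h1 : ∀ s : Fin 2, max s 1 = 1 := by decide
    rintro a b (ha | ⟨hV, ha⟩) (hb | ⟨hV', hb⟩)
    · exact Or.inl (add_mem ha hb)
    · exact Or.inr ⟨hV', by rw [RTilde.add_lvl, hb, h1]⟩
    · exact Or.inr ⟨hV, by rw [RTilde.add_lvl, ha, max_comm, h1]⟩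
    · exact Or.inr ⟨hV, by rw [RTilde.add_lvl, hb, h1]⟩

variable (L)

/-- The monoid `S^u_{0,b}(O; Ṽ)` of bounded, compactly supported, upper semicontinuous functions
whose value at each `P` lies in `Ṽ_P`. -/
def bddV : AddSubmonoid (MSpec (integralClosure o L) → RTilde) where
  carrier := {f | f ∈ bddUSC (MSpec (integralClosure o L)) ∧ ∀ P, f P ∈ vTildeAt o K P}
  zero_mem' := ⟨zero_mem _, fun _ => zero_mem _⟩
  add_mem' := fun hf hg => ⟨add_mem hf.1 hg.1, fun P => add_mem (hf.2 P) (hg.2 P)⟩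

/-- The monoid `S^u_{0,ref}(O; Ṽ)` of reflexible functions whose value at each `P` lies in `Ṽ_P`. -/
def reflV : AddSubmonoid (MSpec (integralClosure o L) → RTilde) where
  carrier := {f | f ∈ reflUSC (MSpec (integralClosure o L)) ∧ ∀ P, f P ∈ vTildeAt o K P}
  zero_mem' := ⟨zero_mem _, fun _ => zero_mem _⟩
  add_mem' := fun hf hg => ⟨add_mem hf.1 hg.1, fun P => add_mem (hf.2 P) (hg.2 P)⟩

/-- The monoid (in fact a group) `S^u_{0,ref}(O; val)` of reflexible functions whose value at each
`P` lies in `val_P`. -/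
def reflVal : AddSubmonoid (MSpec (integralClosure o L) → RTilde) where
  carrier := {f | f ∈ reflUSC (MSpec (integralClosure o L)) ∧ ∀ P, f P ∈ valAt o K P}
  zero_mem' := ⟨zero_mem _, fun _ => zero_mem _⟩
  add_mem' := fun hf hg => ⟨add_mem hf.1 hg.1, fun P => add_mem (hf.2 P) (hg.2 P)⟩

/-- `S^u_{0,ref}(O; Ṽ)` as a submonoid of `S^u_{0,b}(O; Ṽ)`. -/
noncomputable def reflVIn : AddSubmonoid (bddV o K L) := (reflV o K L).comap (bddV o K L).subtype

/-- `S^u_{0,ref}(O; val)` as a submonoid of `S^u_{0,b}(O; Ṽ)`. -/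
noncomputable def reflValIn : AddSubmonoid (bddV o K L) := (reflVal o K L).comap (bddV o K L).subtype

/-- The quotient monoid `S^u_{0,b}(O; Ṽ) / S^u_{0,ref}(O; val)`. -/
abbrev FunctionQuotient : Type _ := (reflValIn o K L).modCon.Quotient

/-- The projection `S^u_{0,b}(O; Ṽ) → S^u_{0,b}(O; Ṽ) / S^u_{0,ref}(O; val)`. -/
noncomputable def toFunctionQuotient : bddV o K L →+ FunctionQuotient o K L := (reflValIn o K L).modCon.mk'

end Valuation

/-! ### Fractional ideals and ideal class semigroups -/

section Ideals

open nonZeroDivisors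

variable (o L : Type*) [CommRing o] [Field L] [Algebra o L]

/-- The monoid of nonzero fractional ideals of the integral closure of `o` in `L`. -/
def FracIdeals : Submonoid (FractionalIdeal (integralClosure o L)⁰ L) where
  carrier := {I | I ≠ 0}
  one_mem' := by
    intro h
    have h1 : (1 : L) ∈ (1 : FractionalIdeal (integralClosure o L)⁰ L) :=
      (FractionalIdeal.mem_one_iff _).2 ⟨1, map_one _⟩
    rw [h, FractionalIdeal.mem_zero_iff] at h1
    exact one_ne_zero h1
  mul_mem' := by
    intro I J hI hJ h
    refine hI (FractionalIdeal.eq_zero_iff.2 fun x hx => ?_)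
    by_contra hx0
    refine hJ (FractionalIdeal.eq_zero_iff.2 fun y hy => ?_)
    have := FractionalIdeal.mul_mem_mul hx hy
    rw [h, FractionalIdeal.mem_zero_iff] at this
    exact (mul_eq_zero.1 this).resolve_left hx0

/-- The submonoid of principal fractional ideals `a O`, for `a ∈ Lˣ`. -/
def principalIdeals : Submonoid (FracIdeals o L) where
  carrier := {I | ∃ a : Lˣ, ((I : FractionalIdeal (integralClosure o L)⁰ L) :
    Submodule (integralClosure o L) L) = Submodule.span (integralClosure o L) {(a : L)}}
  one_mem' := ⟨1, by simp [Submodule.one_eq_span]⟩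
  mul_mem' := by
    rintro I J ⟨a, ha⟩ ⟨b, hb⟩
    exact ⟨a * b, by simp [ha, hb, Submodule.span_mul_span]⟩

/-- The submonoid of invertible fractional ideals. -/
def invertibleIdeals : Submonoid (FracIdeals o L) where
  carrier := {I | ∃ J : FracIdeals o L, I * J = 1}
  one_mem' := ⟨1, one_mul 1⟩
  mul_mem' := by
    rintro I J ⟨I', hI⟩ ⟨J', hJ⟩
    exact ⟨I' * J', by rw [mul_mul_mul_comm, hI, hJ, one_mul]⟩

/-- The ideal class semigroup: fractional ideals modulo principal ones. -/
abbrev IdealClassSemigroup : Type _ := (principalIdeals o L).modCon.Quotient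

/-- The Picard group, i.e. the classes of the invertible fractional ideals, inside the ideal class
semigroup. -/
def picardGroup : Submonoid (IdealClassSemigroup o L) :=
  (invertibleIdeals o L).map (principalIdeals o L).modCon.mk'

/-- The quotient of the ideal class semigroup by the Picard group. -/
abbrev ClassModPic : Type _ := (picardGroup o L).modCon.Quotient

/-- The projection from the ideal class semigroup to its quotient by the Picard group. -/
def classToModPic : IdealClassSemigroup o L →* ClassModPic o L := (picardGroup o L).modCon.mk'

/-- The map sending a fractional ideal `I` to the image of its class `[I]` modulo the Picard
group. -/
def toClassModPic : FracIdeals o L →* ClassModPic o L :=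
  (classToModPic o L).comp (principalIdeals o L).modCon.mk'

/-- The image in the quotient by the Picard group of the von Neumann regular part of the ideal
class semigroup. -/
def regClassModPic : Submonoid (ClassModPic o L) :=
  (vonNeumannRegular (IdealClassSemigroup o L)).map (classToModPic o L)

end Ideals

section FTilde

open nonZeroDivisors

variable (o K : Type*) {L : Type*} [CommRing o] [Field K]
  [Field L] [Algebra K L] [Algebra o L]

/-- `f_I(P) = inf {v_P(x) | x ∈ I, x ≠ 0}`. -/
noncomputable def fReal (I : FracIdeals o L) (P : MSpec (integralClosure o L)) : ℝ :=
  sInf {r : ℝ | ∃ x : Lˣ, (x : L) ∈ (I : FractionalIdeal (integralClosure o L)⁰ L) ∧ (ord o K P x : ℝ) = r}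

open Classical in
/-- `f_I(P)` together with the level `0` if the infimum defining `f_I(P)` is attained, and `1`
otherwise. -/
noncomputable def fTilde (I : FracIdeals o L) (P : MSpec (integralClosure o L)) : RTilde :=
  ⟨fReal o K I P,
    if ∃ x : Lˣ, (x : L) ∈ (I : FractionalIdeal (integralClosure o L)⁰ L) ∧ (ord o K P x : ℝ) = fReal o K I P
    then 0 else 1⟩

end FTilde

/-!
The map `I ↦ fTilde I` is an isomorphism from the monoid of fractional ideals of the integral
closure `O` onto the whole monoid of functions `bddV`, and everything else follows formally.

The pair `fTilde I P` is the greatest lower bound in `ℝ × {0, 1}` of the pairs `(v_P(x), 0)` with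
`0 ≠ x ∈ I` (`isGLB_fTilde`): the second component records whether the infimum is attained. For
fixed `x`, the function `P ↦ v_P(x)` is locally constant (`isLocallyConstant_ord`), and it vanishes
off the compact set of all `P` containing some non-zero `a`; compactness holds because `O` has
dimension one (`MSpec.isCompact_setOf_mem`). Upper semicontinuity, boundedness and compact support
of `fTilde I` follow, and so does additivity, since greatest lower bounds add up. An infimum which
is not attained forces the value group at `P` to be dense.

Injectivity: `O` and its fractional ideals are the intersections of their localizations at the
maximal ideals, and these localizations are valuation rings, so `I` consists of `0` and the `x` with
`fTilde I P ≤ (v_P(x), 0)` for all `P` (`mem_iff_forall_fTilde_le`). Surjectivity: for a given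
function `f`, the `x` with `f(P) ≤ (v_P(x), 0)` for all `P` form a fractional ideal, and it has
enough elements to have `f` as its greatest lower bound, by an approximation argument on compact
sets of maximal ideals (`exists_ord_eq_and_le`).

Under this isomorphism the invertible ideals, i.e. the units, correspond to the reflexible functions
with values in `val` (`mem_reflValIn_iff`), and the von Neumann regular ideals to the reflexible
functions (`mem_reflVIn_iff`). As principal ideals are units, passing to ideal classes affects
neither the quotient by the invertible ideals nor regularity.
-/

/-! ### The topology of the maximal spectrum -/

namespace MSpec

open Filter Topology

variable {R : Type*} [CommRing R]

instance (P : MSpec R) : P.asIdeal.IsMaximal := MaximalSpectrum.isMaximal P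

theorem exists_asIdeal_eq {I : Ideal R} (hI : I.IsMaximal) : ∃ P : MSpec R, P.asIdeal = I :=
  ⟨(⟨I, hI⟩ : MaximalSpectrum R), rfl⟩

theorem asIdeal_injective : Function.Injective (asIdeal : MSpec R → Ideal R) :=
  fun _ _ h => MaximalSpectrum.ext h

theorem isOpen_setOf_subset (A : Finset R) :
    IsOpen {P : MSpec R | (A : Set R) ⊆ (P.asIdeal : Set R)} :=
  (isTopologicalBasis R).isOpen ⟨A, rfl⟩

theorem isOpen_setOf_mem (a : R) : IsOpen {P : MSpec R | a ∈ P.asIdeal} := by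
  simpa using isOpen_setOf_subset {a}

theorem isOpen_setOf_le {I : Ideal R} (hI : I.FG) : IsOpen {P : MSpec R | I ≤ P.asIdeal} := by
  obtain ⟨A, rfl⟩ := hI
  simpa only [Ideal.span_le] using isOpen_setOf_subset A

/-- If `a ∉ P`, then `r * a - 1 ∈ P` for some `r`, and the maximal ideals containing `r * a - 1` do
not contain `a`. -/
theorem isOpen_setOf_notMem (a : R) : IsOpen {P : MSpec R | a ∉ P.asIdeal} := by
  rw [isOpen_iff_mem_nhds]
  intro P hP
  obtain ⟨r, i, hi, e⟩ := Ideal.IsMaximal.exists_inv (I := P.asIdeal) inferInstance hP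
  refine mem_of_superset ((isOpen_setOf_mem i).mem_nhds hi) fun Q (hQ : i ∈ Q.asIdeal) haQ => ?_
  refine (Ideal.ne_top_iff_one Q.asIdeal).1 (Ideal.IsMaximal.ne_top inferInstance) ?_
  rw [← e]
  exact add_mem (Q.asIdeal.mul_mem_left r haQ) hQ

/-- An ultrafilter on `{P | a ∈ P}` converges to the ideal of those `x` for which it contains
`{P | x ∈ P}`: this is a non-zero prime ideal, hence maximal. -/
theorem isCompact_setOf_mem [IsDomain R] [Ring.DimensionLEOne R] {a : R} (ha : a ≠ 0) :
    IsCompact {P : MSpec R | a ∈ P.asIdeal} := by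
  rw [isCompact_iff_ultrafilter_le_nhds]
  intro 𝓕 h𝓕
  rw [le_principal_iff] at h𝓕
  let I : Ideal R :=
    { carrier := {x | {P : MSpec R | x ∈ P.asIdeal} ∈ 𝓕}
      add_mem' := fun {x y} hx hy => by
        filter_upwards [hx, hy] with P hx hy using add_mem hx hy
      zero_mem' := by simp [← Ultrafilter.mem_coe]
      smul_mem' := fun r x hx => by
        filter_upwards [hx] with P hx using P.asIdeal.mul_mem_left r hx }
  have hmem : ∀ x, x ∈ I ↔ {P : MSpec R | x ∈ P.asIdeal} ∈ 𝓕 := fun x => Iff.rfl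
  have hp : I.IsPrime := by
    refine ⟨fun h => ?_, fun {x y} hxy => ?_⟩
    · rw [Ideal.eq_top_iff_one, hmem] at h
      obtain ⟨P, hP⟩ := 𝓕.nonempty_of_mem h
      exact (Ideal.ne_top_iff_one P.asIdeal).1 (Ideal.IsMaximal.ne_top inferInstance) hP
    · rw [hmem, hmem, ← Ultrafilter.union_mem_iff]
      rw [hmem] at hxy
      filter_upwards [hxy] with P hP
      exact Ideal.IsPrime.mem_or_mem inferInstance hP
  obtain ⟨P, hP⟩ := exists_asIdeal_eq (hp.isMaximal (fun h => ha <| by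
    have : a ∈ I := h𝓕
    rwa [h] at this))
  refine ⟨P, show a ∈ P.asIdeal from hP ▸ h𝓕, ?_⟩
  rw [(isTopologicalBasis R).nhds_hasBasis.ge_iff]
  rintro _ ⟨⟨A, rfl⟩, hA⟩
  have : ⋂ x ∈ A, {P : MSpec R | x ∈ P.asIdeal} ∈ 𝓕 := by
    rw [← Ultrafilter.mem_coe, biInter_finset_mem]
    intro x hx
    exact (hmem x).1 (hP ▸ hA hx)
  filter_upwards [this] with Q hQ x hx
  exact Set.mem_iInter₂.1 hQ x hx

theorem exists_mem_of_isCompact [IsDomain R] (hR : ¬ IsField R) {C : Set (MSpec R)}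
    (hC : IsCompact C) : ∃ a : R, a ≠ 0 ∧ ∀ P ∈ C, a ∈ P.asIdeal := by
  refine hC.induction_on ⟨1, one_ne_zero, by simp⟩ ?_ ?_ ?_
  · rintro s t hst ⟨a, ha, h⟩
    exact ⟨a, ha, fun P hP => h P (hst hP)⟩
  · rintro s t ⟨a, ha, h⟩ ⟨b, hb, h'⟩
    refine ⟨a * b, mul_ne_zero ha hb, ?_⟩
    rintro P (hP | hP)
    · exact P.asIdeal.mul_mem_right b (h P hP)
    · exact P.asIdeal.mul_mem_left a (h' P hP)
  · intro P _
    obtain ⟨a, haP, ha⟩ := Submodule.exists_mem_ne_zero_of_ne_bot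
      (Ring.ne_bot_of_isMaximal_of_not_isField (M := P.asIdeal) inferInstance hR)
    exact ⟨_, mem_nhdsWithin_of_mem_nhds ((isOpen_setOf_mem a).mem_nhds haP), a, ha, fun _ h => h⟩

theorem exists_notMem_of_isCompact {C : Set (MSpec R)} (hC : IsCompact C) {P : MSpec R}
    (hP : P ∉ C) : ∃ y, y ∉ P.asIdeal ∧ ∀ Q ∈ C, y ∈ Q.asIdeal := by
  refine hC.induction_on
    ⟨1, (Ideal.ne_top_iff_one _).1 (Ideal.IsMaximal.ne_top inferInstance), by simp⟩ ?_ ?_ ?_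
  · rintro s t hst ⟨a, ha, h⟩
    exact ⟨a, ha, fun P hP => h P (hst hP)⟩
  · rintro s t ⟨a, ha, h⟩ ⟨b, hb, h'⟩
    refine ⟨a * b, fun hab => (Ideal.IsPrime.mem_or_mem inferInstance hab).elim ha hb, ?_⟩
    rintro Q (hQ | hQ)
    · exact Q.asIdeal.mul_mem_right b (h Q hQ)
    · exact Q.asIdeal.mul_mem_left a (h' Q hQ)
  · intro Q hQ
    have hne : Q.asIdeal ≠ P.asIdeal := fun h => hP (asIdeal_injective h ▸ hQ)
    obtain ⟨y, hyQ, hyP⟩ : ∃ y ∈ Q.asIdeal, y ∉ P.asIdeal := by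
      by_contra! h
      exact hne (Ideal.IsMaximal.eq_of_le inferInstance (Ideal.IsMaximal.ne_top inferInstance) h)
    exact ⟨_, mem_nhdsWithin_of_mem_nhds ((isOpen_setOf_mem y).mem_nhds hyQ), y, hyP, fun _ h => h⟩

end MSpec

/-! ### Order and addition on `ℝ × {0, 1}` -/

namespace RTilde

theorem lt_mk_zero_iff {a : RTilde} {r : ℝ} : a < ⟨r, 0⟩ ↔ a.re < r := by
  simp [lt_iff]

theorem le_mk_zero_iff {a : RTilde} {r : ℝ} : a ≤ ⟨r, 0⟩ ↔ a < ⟨r, 1⟩ := by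
  rcases a with ⟨x, s⟩
  rw [lt_iff, le_iff]
  have : s ≤ 0 ↔ s < 1 := by omega
  simp only [this]

theorem mk_zero_le_mk_zero_iff {r s : ℝ} : (⟨r, 0⟩ : RTilde) ≤ ⟨s, 0⟩ ↔ r ≤ s := by
  rw [le_iff, _root_.le_iff_lt_or_eq (a := r)]
  simp

/-- The greatest lower bound of a sumset is the sum of the greatest lower bounds. -/
theorem isGLB_add {ι κ : Type*} {f : ι → ℝ} {g : κ → ℝ} {a b : RTilde}
    (ha : IsGLB (Set.range fun i => (⟨f i, 0⟩ : RTilde)) a)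
    (hb : IsGLB (Set.range fun j => (⟨g j, 0⟩ : RTilde)) b) :
    IsGLB (Set.range fun p : ι × κ => (⟨f p.1 + g p.2, 0⟩ : RTilde)) (a + b) := by
  constructor
  · rintro _ ⟨⟨i, j⟩, rfl⟩
    exact RTilde.add_le_add (ha.1 ⟨i, rfl⟩) (hb.1 ⟨j, rfl⟩)
  · intro c hc
    by_contra! hlt
    have key : ∀ i j, c ≤ ⟨f i + g j, 0⟩ := fun i j => hc ⟨(i, j), rfl⟩
    -- it suffices to lift `a` and `b` to bounds whose sum stays below `c`
    suffices ∃ i j, (⟨f i + g j, 0⟩ : RTilde) < c by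
      obtain ⟨i, j, h⟩ := this
      exact (key i j).not_gt h
    have hfa : ∀ d, a < d → ∃ i, (⟨f i, 0⟩ : RTilde) < d := fun d hd => by
      obtain ⟨_, ⟨i, rfl⟩, h⟩ := (isGLB_lt_iff ha).1 hd
      exact ⟨i, h⟩
    have hgb : ∀ d, b < d → ∃ j, (⟨g j, 0⟩ : RTilde) < d := fun d hd => by
      obtain ⟨_, ⟨i, rfl⟩, h⟩ := (isGLB_lt_iff hb).1 hd
      exact ⟨i, h⟩
    rw [lt_iff, add_re, add_lvl] at hlt
    rcases hlt with hlt | ⟨he, hl⟩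
    · obtain ⟨i, hi⟩ := hfa ⟨a.re + (c.re - a.re - b.re) / 2, 0⟩
        (lt_mk_zero_iff.2 (by linarith))
      obtain ⟨j, hj⟩ := hgb ⟨b.re + (c.re - a.re - b.re) / 2, 0⟩
        (lt_mk_zero_iff.2 (by linarith))
      rw [lt_mk_zero_iff] at hi hj
      refine ⟨i, j, lt_iff.2 (Or.inl ?_)⟩
      dsimp only at hi hj ⊢
      linarith
    · have hl' := max_lt_iff.1 hl
      obtain ⟨i, hi⟩ := hfa ⟨a.re, c.lvl⟩ (lt_iff.2 (Or.inr ⟨rfl, hl'.1⟩))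
      obtain ⟨j, hj⟩ := hgb ⟨b.re, c.lvl⟩ (lt_iff.2 (Or.inr ⟨rfl, hl'.2⟩))
      refine ⟨i, j, ?_⟩
      have h0 : (0 : Fin 2) < c.lvl := lt_of_le_of_lt (Fin.zero_le _) hl
      rw [lt_iff] at hi hj ⊢
      simp only [h0, and_true] at hi hj ⊢
      rw [← le_iff_lt_or_eq] at hi hj ⊢
      linarith

end RTilde

/-! ### The normalized valuations -/

section Ord

open Filter Topology IsDedekindDomain

variable {o : Type*} (K : Type*) {L : Type*} [CommRing o] [Field K] [Field L] [Algebra K L]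
  [Algebra o L]

theorem ord_mul (P : MSpec (integralClosure o L)) (x y : Lˣ) :
    ord o K P (x * y) = ord o K P x + ord o K P y :=
  AddValuation.onUnits_mul _ x y

theorem ord_inv (P : MSpec (integralClosure o L)) (x : Lˣ) : ord o K P x⁻¹ = -ord o K P x :=
  AddValuation.onUnits_inv _ x

theorem ord_one (P : MSpec (integralClosure o L)) : ord o K P 1 = 0 :=
  AddValuation.onUnits_one _

theorem ord_div (P : MSpec (integralClosure o L)) (x y : Lˣ) :
    ord o K P (x / y) = ord o K P x - ord o K P y := by
  rw [div_eq_mul_inv, ord_mul, ord_inv, sub_eq_add_neg]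

theorem ord_pow (P : MSpec (integralClosure o L)) (x : Lˣ) (n : ℕ) :
    ord o K P (x ^ n) = n * ord o K P x :=
  AddValuation.onUnits_pow _ x n

theorem ord_zpow (P : MSpec (integralClosure o L)) (x : Lˣ) (n : ℤ) :
    ord o K P (x ^ n) = n * ord o K P x :=
  AddValuation.onUnits_zpow _ x n

theorem min_ord_le_ord_add (P : MSpec (integralClosure o L)) (x y z : Lˣ)
    (h : (z : L) = x + y) : min (ord o K P x) (ord o K P y) ≤ ord o K P z := by
  have := (normVal o K P).map_add (x : L) y
  rw [← h, ← AddValuation.coe_onUnits, ← AddValuation.coe_onUnits, ← AddValuation.coe_onUnits,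
    ← WithTop.coe_min, WithTop.coe_le_coe] at this
  exact this

theorem not_isField_integralClosure {o L : Type*} [CommRing o] [Field L] [Algebra o L]
    (hinj : Function.Injective (algebraMap o L)) (ho : ¬ IsField o) :
    ¬ IsField (integralClosure o L) := by
  have : IsDomain o := hinj.isDomain _
  have hinj' : Function.Injective (algebraMap o (integralClosure o L)) :=
    Function.Injective.of_comp (f := algebraMap (integralClosure o L) L) hinj
  exact fun h => ho (isField_of_isIntegral_of_isField hinj' h)

theorem injective_algebraMap_of_isScalarTower [Algebra o K] [IsFractionRing o K]
    [IsScalarTower o K L] : Function.Injective (algebraMap o L) := by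
  rw [IsScalarTower.algebraMap_eq o K L]
  exact (algebraMap K L).injective.comp (IsFractionRing.injective o K)

variable [Algebra o K] [IsDedekindDomain o] [IsFractionRing o K] [IsScalarTower o K L]
  [Algebra.IsAlgebraic K L]

include K in
theorem isFractionRing_integralClosure : IsFractionRing (integralClosure o L) L := by
  have : Algebra.IsAlgebraic o L :=
    (IsFractionRing.comap_isAlgebraic_iff (A := o) (K := K) (C := L)).2 inferInstance
  exact integralClosure.isFractionRing_of_algebraic fun a h =>
    injective_algebraMap_of_isScalarTower (o := o) (L := L) K (h.trans (map_zero _).symm)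

variable (ho : ¬ IsField o)
include ho

theorem ord_nonneg_iff (P : MSpec (integralClosure o L)) (x : Lˣ) :
    0 ≤ ord o K P x ↔
      ∃ a s : integralClosure o L, s ∉ P.asIdeal ∧ (s : L) * x = (a : L) := by
  rw [← (normVal_spec o K ho P).integers, ← AddValuation.coe_onUnits, WithTop.coe_nonneg]
  rfl

theorem ord_nonneg_of_mem (P : MSpec (integralClosure o L)) (x : Lˣ)
    (hx : (x : L) ∈ integralClosure o L) : 0 ≤ ord o K P x :=
  (ord_nonneg_iff K ho P x).2
    ⟨⟨x, hx⟩, 1, (Ideal.ne_top_iff_one _).1 (Ideal.IsMaximal.ne_top inferInstance), one_mul _⟩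

theorem ord_pos_iff (P : MSpec (integralClosure o L)) (x : Lˣ) (a : integralClosure o L)
    (h : (x : L) = a) : 0 < ord o K P x ↔ a ∈ P.asIdeal := by
  rw [← not_iff_not, not_lt, ← neg_nonneg, ← ord_inv, ord_nonneg_iff K ho]
  constructor
  · rintro ⟨b, s, hs, e⟩ ha
    rw [Units.val_inv_eq_inv_val, ← div_eq_mul_inv, div_eq_iff x.ne_zero, h] at e
    have : s = b * a := Subtype.ext e
    exact hs (this ▸ P.asIdeal.mul_mem_left b ha)
  · intro ha
    exact ⟨1, a, ha, by simp [← h]⟩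

theorem ord_eq_zero_of_notMem (P : MSpec (integralClosure o L)) (x : Lˣ)
    (a : integralClosure o L) (h : (x : L) = a) (ha : a ∉ P.asIdeal) : ord o K P x = 0 := by
  rw [← ord_pos_iff K ho P x a h, not_lt] at ha
  exact le_antisymm ha (ord_nonneg_of_mem K ho P x (h ▸ a.2))

theorem exists_ord_algebraMap_eq_one (P : MSpec (integralClosure o L)) :
    ∃ c : Kˣ, ord o K P (Units.map (algebraMap K L).toMonoidHom c) = 1 := by
  have h := (normVal_spec o K ho P).normalized
  have h1 : ((1 : ℚ) : WithTop ℚ) ∈ Set.range (fun n : ℤ => (((n : ℚ)) : WithTop ℚ)) :=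
    ⟨1, by simp⟩
  rw [← h] at h1
  obtain ⟨c, hc⟩ := h1
  refine ⟨c, ?_⟩
  rw [← WithTop.coe_inj, ord, AddValuation.coe_onUnits]
  exact hc

theorem exists_ord_algebraMap_eq_intCast (P : MSpec (integralClosure o L)) (c : Kˣ) :
    ∃ m : ℤ, ord o K P (Units.map (algebraMap K L).toMonoidHom c) = m := by
  have h := (normVal_spec o K ho P).normalized
  have h1 : normVal o K P (algebraMap K L c) ∈
      Set.range (fun c : Kˣ => normVal o K P (algebraMap K L c)) := ⟨c, rfl⟩
  rw [h] at h1
  obtain ⟨m, hm⟩ := h1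
  refine ⟨m, ?_⟩
  rw [← WithTop.coe_inj, ord, AddValuation.coe_onUnits]
  exact hm.symm

/-- On `K`, the normalized valuation at `P` is the `p`-adic valuation, for `p = P ∩ o`. -/
theorem ord_algebraMap_eq (P : MSpec (integralClosure o L)) (p : HeightOneSpectrum o)
    (hp : P.asIdeal.comap (algebraMap o (integralClosure o L)) = p.asIdeal) (c : Kˣ) :
    ord o K P (Units.map (algebraMap K L).toMonoidHom c) =
      -((WithZero.log (p.valuation K (c : K)) : ℤ) : ℚ) := by
  set j : Kˣ →* Lˣ := Units.map (algebraMap K L).toMonoidHom with hj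
  have hjo : ∀ (a : o) (c : Kˣ), (c : K) = algebraMap o K a →
      ((j c : Lˣ) : L) = ((algebraMap o (integralClosure o L) a : integralClosure o L) : L) := by
    intro a c h
    change algebraMap K L c = _
    rw [h, ← IsScalarTower.algebraMap_apply o K L]
    rfl
  -- elements of `K` prime to `p` are prime to `P`
  have h1 : ∀ c : Kˣ, p.valuation K (c : K) = 1 → ord o K P (j c) = 0 := by
    intro c hc
    obtain ⟨n, d, h⟩ := p.exists_primeCompl_mul_eq_of_integer (c : K) hc.le
    have hd : (d : o) ∉ p.asIdeal := d.2
    have hdv := (HeightOneSpectrum.valuation_eq_one_iff_notMem (K := K) p).2 hd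
    have hn : n ∉ p.asIdeal := by
      rw [← HeightOneSpectrum.valuation_eq_one_iff_notMem (K := K), ← h, map_mul, hc, one_mul]
      exact hdv
    have hd0 : algebraMap o K d ≠ 0 := fun h0 => by simp [h0] at hdv
    have hn0 : algebraMap o K n ≠ 0 := h ▸ mul_ne_zero c.ne_zero hd0
    have e : c * Units.mk0 _ hd0 = Units.mk0 _ hn0 := Units.ext h
    have e1 := ord_eq_zero_of_notMem K ho P (j (Units.mk0 _ hd0)) _ (hjo d _ rfl)
      (fun hm => hd (hp.le hm))
    have e2 := ord_eq_zero_of_notMem K ho P (j (Units.mk0 _ hn0)) _ (hjo n _ rfl)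
      (fun hm => hn (hp.le hm))
    rwa [← e, map_mul, ord_mul, e1, add_zero] at e2
  obtain ⟨π, hπ'⟩ := p.valuation_exists_uniformizer' K
  have hπ : p.valuation K (algebraMap o K π) = WithZero.exp (-1) := hπ'
  have hπ0 : algebraMap o K π ≠ 0 := by
    intro h
    rw [h, map_zero] at hπ
    exact WithZero.exp_ne_zero hπ.symm
  set t : Kˣ := Units.mk0 _ hπ0 with ht
  have h2 : ∀ c : Kˣ, ord o K P (j c) = -((WithZero.log (p.valuation K (c : K)) : ℤ) : ℚ) *
      ord o K P (j t) := by
    intro c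
    have hc' : p.valuation K (c : K) ≠ 0 := by rw [Valuation.ne_zero_iff]; exact c.ne_zero
    have := h1 (c * t ^ (WithZero.log (p.valuation K (c : K)))) (by
      rw [Units.val_mul, Units.val_zpow_eq_zpow_val, map_mul, map_zpow₀, ht, Units.val_mk0, hπ,
        ← WithZero.exp_zsmul]
      nth_rewrite 1 [← WithZero.exp_log hc']
      rw [← WithZero.exp_add]
      simp)
    rw [map_mul, map_zpow, ord_mul, ord_zpow] at this
    linarith
  -- `v_P` maps `Kˣ` onto `ℤ`, so the non-negative integer `v_P(π)` is `1`
  have h3 : ord o K P (j t) = 1 := by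
    obtain ⟨k, hk⟩ := exists_ord_algebraMap_eq_intCast K ho P t
    obtain ⟨u, hu⟩ := exists_ord_algebraMap_eq_one K ho P
    have hk0 : 0 ≤ k := by
      have := ord_nonneg_of_mem K ho P (j t) (by
        rw [hjo π t rfl]
        exact SetLike.coe_mem (algebraMap o (integralClosure o L) π))
      rw [hk] at this
      exact_mod_cast this
    rw [← hj] at hk hu
    rw [h2 u, hk] at hu
    have hkm : -WithZero.log (p.valuation K (u : K)) * k = 1 := by exact_mod_cast hu
    rw [hk]
    rcases Int.isUnit_iff.1 (IsUnit.of_mul_eq_one_right _ hkm) with e | e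
    · simp [e]
    · omega
  rw [h2 c, h3, mul_one]

/-- On `K`, the valuation at `P` depends only on the prime `P ∩ o`, and as this prime is finitely
generated, the set of all `Q` over it is open. An element of `L` differs from an element of `K` by
taking a power and by a factor which is a unit at `P`, and therefore at all `Q` close to `P`. -/
theorem isLocallyConstant_ord (x : Lˣ) :
    IsLocallyConstant fun P : MSpec (integralClosure o L) => ord o K P x := by
  rw [IsLocallyConstant.iff_eventually_eq]
  intro P
  set j : Kˣ →* Lˣ := Units.map (algebraMap K L).toMonoidHom with hj
  have hpm : ∀ Q : MSpec (integralClosure o L),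
      (Q.asIdeal.comap (algebraMap o (integralClosure o L))).IsMaximal := fun Q =>
    Ideal.isMaximal_comap_of_isIntegral_of_isMaximal Q.asIdeal
  let p : HeightOneSpectrum o := ⟨P.asIdeal.comap (algebraMap o (integralClosure o L)),
    (hpm P).isPrime, fun h => ho (Ring.isField_iff_maximal_bot.2 (h ▸ hpm P))⟩
  have hK : ∀ c : Kˣ, ∀ᶠ Q in 𝓝 P, ord o K Q (j c) = ord o K P (j c) := by
    intro c
    have hfg : (p.asIdeal.map (algebraMap o (integralClosure o L))).FG :=
      Ideal.FG.map (IsNoetherian.noetherian p.asIdeal) _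
    filter_upwards [(MSpec.isOpen_setOf_le hfg).mem_nhds (Ideal.map_comap_le : _ ≤ P.asIdeal)]
      with Q (hQ : _ ≤ Q.asIdeal)
    rw [ord_algebraMap_eq K ho P p rfl, ord_algebraMap_eq K ho Q p]
    exact (Ideal.IsMaximal.eq_of_le (hpm P) (hpm Q).ne_top (Ideal.map_le_iff_le_comap.1 hQ)).symm
  obtain ⟨u, hu⟩ := exists_ord_algebraMap_eq_one K ho P
  set q := ord o K P x with hq
  have hden : ((q.den : ℕ) : ℚ) ≠ 0 := by exact_mod_cast q.den_nz
  -- with `v_P(x) = q` and `v_P(u) = 1`, this `y` has valuation zero at `P`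
  set y : Lˣ := x ^ q.den * j u ^ (-q.num) with hy
  have hyord : ∀ Q : MSpec (integralClosure o L), ord o K Q y =
      q.den * ord o K Q x - q.num * ord o K Q (j u) := by
    intro Q
    rw [hy, ord_mul, ord_pow, ord_zpow]
    push_cast
    ring
  have hyP : ord o K P y = 0 := by
    rw [hyord, ← hq, hu, Rat.den_mul_eq_num]
    ring
  obtain ⟨a, s, hs, e⟩ := (ord_nonneg_iff K ho P y).1 hyP.ge
  have ha : a ∉ P.asIdeal := by
    have hs0 : (s : L) ≠ 0 := fun h => hs (by
      rw [show s = 0 from Subtype.ext h]; exact zero_mem _)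
    rw [← ord_pos_iff K ho P (Units.mk0 _ hs0 * y) a e, ord_mul, hyP,
      ord_eq_zero_of_notMem K ho P _ s rfl hs]
    simp
  filter_upwards [hK u, (MSpec.isOpen_setOf_notMem s).mem_nhds hs,
    (MSpec.isOpen_setOf_notMem a).mem_nhds ha] with Q hQu (hQs : s ∉ Q.asIdeal)
    (hQa : a ∉ Q.asIdeal)
  have hs0 : (s : L) ≠ 0 := fun h => hs (by
    rw [show s = 0 from Subtype.ext h]; exact zero_mem _)
  have h1 := ord_eq_zero_of_notMem K ho Q (Units.mk0 _ hs0 * y) a e hQa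
  rw [ord_mul, ord_eq_zero_of_notMem K ho Q _ s rfl hQs, zero_add, hyord, hQu, hu, mul_one] at h1
  apply mul_left_cancel₀ hden
  rw [Rat.den_mul_eq_num]
  linarith

/-- Writing `x` as a fraction of elements of the integral closure, the valuation of `x` vanishes at
all `P` which contain neither the numerator nor the denominator. -/
theorem exists_ord_eq_zero (x : Lˣ) : ∃ a : integralClosure o L, a ≠ 0 ∧
    ∀ P : MSpec (integralClosure o L), a ∉ P.asIdeal → ord o K P x = 0 := by
  have := isFractionRing_integralClosure (o := o) (L := L) K
  obtain ⟨b, d, hd, e⟩ := IsFractionRing.div_surjective (A := integralClosure o L) (x : L)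
  change (b : L) / (d : L) = x at e
  have hd0 : (d : L) ≠ 0 := fun h => nonZeroDivisors.ne_zero hd (Subtype.ext h)
  have hb0 : (b : L) ≠ 0 := fun h => x.ne_zero (by rw [← e, h, zero_div])
  refine ⟨b * d, mul_ne_zero (fun h => hb0 (by simp [h])) (fun h => hd0 (by simp [h])),
    fun P hP => ?_⟩
  have hx : x = Units.mk0 _ hb0 / Units.mk0 _ hd0 := Units.ext (by simp [e])
  rw [hx, ord_div, ord_eq_zero_of_notMem K ho P _ b rfl, ord_eq_zero_of_notMem K ho P _ d rfl,
    sub_zero]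
  · exact fun h => hP (P.asIdeal.mul_mem_left b h)
  · exact fun h => hP (P.asIdeal.mul_mem_right d h)

theorem exists_abs_ord_le (x : Lˣ) :
    ∃ N : ℕ, ∀ P : MSpec (integralClosure o L), |ord o K P x| ≤ N := by
  obtain ⟨a, ha, h⟩ := exists_ord_eq_zero K ho x
  have hc := MSpec.isCompact_setOf_mem ha
  obtain ⟨N, hN⟩ : ∃ N : ℕ, ∀ P ∈ {P : MSpec (integralClosure o L) | a ∈ P.asIdeal},
      |ord o K P x| ≤ N := by
    refine hc.induction_on ⟨0, by simp⟩ ?_ ?_ ?_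
    · rintro s t hst ⟨N, hN⟩
      exact ⟨N, fun P hP => hN P (hst hP)⟩
    · rintro s t ⟨N, hN⟩ ⟨M, hM⟩
      refine ⟨max N M, ?_⟩
      rintro P (hP | hP)
      · exact (hN P hP).trans (by simp)
      · exact (hM P hP).trans (by simp)
    · intro P _
      obtain ⟨N, hN⟩ := exists_nat_ge |ord o K P x|
      refine ⟨_, mem_nhdsWithin_of_mem_nhds
        ((IsLocallyConstant.iff_eventually_eq _).1 (isLocallyConstant_ord K ho x) P), N, ?_⟩
      rintro Q (hQ : ord o K Q x = ord o K P x)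
      rwa [hQ]
  refine ⟨N, fun P => ?_⟩
  by_cases hP : a ∈ P.asIdeal
  · exact hN P hP
  · rw [h P hP, abs_zero]
    exact N.cast_nonneg

theorem exists_le_ord_pow (y : Lˣ) {C : Set (MSpec (integralClosure o L))} (hC : IsCompact C)
    (hy : ∀ P ∈ C, 0 < ord o K P y) (N : ℝ) :
    ∃ M : ℕ, ∀ P ∈ C, N ≤ (ord o K P (y ^ M) : ℝ) := by
  rcases lt_or_ge N 0 with hN | hN
  · exact ⟨0, fun P _ => by simp [ord_one, hN.le]⟩
  obtain ⟨M, hM⟩ : ∃ M : ℕ, ∀ P ∈ C, 0 < ord o K P y → N ≤ (M * ord o K P y : ℝ) := by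
    refine hC.induction_on ⟨0, by simp⟩ ?_ ?_ ?_
    · rintro s t hst ⟨N, hN⟩
      exact ⟨N, fun P hP => hN P (hst hP)⟩
    · rintro s t ⟨k, hk⟩ ⟨l, hl⟩
      refine ⟨max k l, ?_⟩
      rintro P (hP | hP) hpos <;> have hpos' : (0 : ℝ) < ord o K P y := by exact_mod_cast hpos
      · refine (hk P hP hpos).trans (mul_le_mul_of_nonneg_right ?_ hpos'.le)
        exact_mod_cast le_max_left k l
      · refine (hl P hP hpos).trans (mul_le_mul_of_nonneg_right ?_ hpos'.le)
        exact_mod_cast le_max_right k l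
    · intro P _
      obtain ⟨M, hM⟩ := exists_nat_ge (N / (ord o K P y : ℝ))
      refine ⟨_, mem_nhdsWithin_of_mem_nhds
        ((IsLocallyConstant.iff_eventually_eq _).1 (isLocallyConstant_ord K ho y) P), M, ?_⟩
      rintro Q (hQ : ord o K Q y = ord o K P y) hpos
      rw [hQ] at hpos ⊢
      exact (div_le_iff₀ (by exact_mod_cast hpos)).1 hM
  exact ⟨M, fun P hP => by simpa [ord_pow] using hM P hP (hy P hP)⟩

/-- A submodule `I` of `L` is the intersection of its localizations at the maximal ideals, and as
the local rings are valuation rings, membership in these can be read off from the valuations. -/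
theorem mem_of_forall_ord_le (I : Submodule (integralClosure o L) L) (x : Lˣ)
    (h : ∀ P : MSpec (integralClosure o L), ∃ y : Lˣ, (y : L) ∈ I ∧ ord o K P y ≤ ord o K P x) :
    (x : L) ∈ I := by
  let J : Ideal (integralClosure o L) := I.comap (LinearMap.toSpanSingleton _ L (x : L))
  have hJ : ∀ s : integralClosure o L, s ∈ J ↔ (s : L) * x ∈ I := fun s => Iff.rfl
  by_contra hx
  have hJ1 : J ≠ ⊤ := by
    rw [Ideal.ne_top_iff_one, hJ]
    simpa using hx
  obtain ⟨m, hm, hle⟩ := J.exists_le_maximal hJ1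
  obtain ⟨P, rfl⟩ := MSpec.exists_asIdeal_eq hm
  obtain ⟨y, hy, hyx⟩ := h P
  obtain ⟨a, s, hs, e⟩ := (ord_nonneg_iff K ho P (x / y)).1 (by rw [ord_div]; linarith)
  refine hs (hle ((hJ s).2 ?_))
  have : (s : L) * x = a • (y : L) := by
    change _ = (a : L) * y
    rw [← e, Units.val_div_eq_div_val]
    field_simp
  rw [this]
  exact I.smul_mem a hy

theorem mem_integralClosure_of_forall_ord_nonneg (x : Lˣ)
    (h : ∀ P : MSpec (integralClosure o L), 0 ≤ ord o K P x) : (x : L) ∈ integralClosure o L := by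
  have := mem_of_forall_ord_le K ho (1 : Submodule (integralClosure o L) L) x
    fun P => ⟨1, Submodule.one_le.1 le_rfl, by rw [ord_one]; exact h P⟩
  obtain ⟨a, ha⟩ := Submodule.mem_one.1 this
  exact ha ▸ a.2

end Ord

/-! ### The functions attached to fractional ideals -/

section FTildeMap

open Filter Topology nonZeroDivisors

variable {o : Type*} (K : Type*) {L : Type*} [CommRing o] [Field K] [Field L] [Algebra K L]
  [Algebra o L]

/-- The pairs `(v_P(x), 0)`, for `x` a non-zero element of `I`. -/
def ordSet (I : FracIdeals o L) (P : MSpec (integralClosure o L)) : Set RTilde :=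
  Set.range fun x : {x : Lˣ // (x : L) ∈ (I : FractionalIdeal (integralClosure o L)⁰ L)} =>
    ⟨ord o K P x, 0⟩

theorem exists_unit_mem (I : FracIdeals o L) :
    ∃ x : Lˣ, (x : L) ∈ (I : FractionalIdeal (integralClosure o L)⁰ L) := by
  by_contra! h
  refine I.2 (FractionalIdeal.eq_zero_iff.2 fun x hx => ?_)
  by_contra hx0
  exact h (Units.mk0 x hx0) hx

theorem exists_unit_mul_mem (I : FracIdeals o L) :
    ∃ d : Lˣ, ∀ x ∈ (I : FractionalIdeal (integralClosure o L)⁰ L),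
      (d : L) * x ∈ integralClosure o L := by
  obtain ⟨d, hd, h⟩ := (I : FractionalIdeal (integralClosure o L)⁰ L).isFractional
  refine ⟨Units.mk0 (d : L) fun h0 => nonZeroDivisors.ne_zero hd (Subtype.ext h0), fun x hx => ?_⟩
  obtain ⟨a, ha⟩ := h x hx
  rw [Units.val_mk0, show (d : L) * x = d • x from rfl, ← ha]
  exact a.2

/-- The value group `v_P(Lˣ)`, as a subgroup of `ℝ`. -/
noncomputable def ordRange (P : MSpec (integralClosure o L)) : AddSubgroup ℝ where
  carrier := Set.range fun x : Lˣ => (ord o K P x : ℝ)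
  zero_mem' := ⟨1, by simp [ord_one]⟩
  add_mem' := by
    rintro _ _ ⟨x, rfl⟩ ⟨y, rfl⟩
    exact ⟨x * y, by simp [ord_mul]⟩
  neg_mem' := by
    rintro _ ⟨x, rfl⟩
    exact ⟨x⁻¹, by simp [ord_inv]⟩

theorem valClosure_eq_univ_iff (P : MSpec (integralClosure o L)) :
    valClosure o K P = Set.univ ↔ Dense (ordRange K P : Set ℝ) :=
  dense_iff_closure_eq.symm

theorem exists_ord_of_mem_vTildeAt {P : MSpec (integralClosure o L)} {t b : RTilde}
    (ht : t ∈ vTildeAt o K P) (htb : t < b) :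
    ∃ x : Lˣ, t ≤ ⟨ord o K P x, 0⟩ ∧ (⟨ord o K P x, 0⟩ : RTilde) < b := by
  rcases ht with ⟨⟨x, hx⟩, h0⟩ | ⟨hV, h1⟩
  · have : t = ⟨ord o K P x, 0⟩ := RTilde.ext hx h0
    exact ⟨x, this.le, this ▸ htb⟩
  · have hlt : t.re < b.re := by
      rw [RTilde.lt_iff, h1] at htb
      exact htb.resolve_right fun h => absurd h.2 (Fin.le_last b.lvl).not_gt
    obtain ⟨_, ⟨x, rfl⟩, hx⟩ :=
      ((valClosure_eq_univ_iff K P).1 hV).exists_between hlt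
    exact ⟨x, RTilde.le_iff.2 (Or.inl hx.1), RTilde.lt_iff.2 (Or.inl hx.2)⟩

theorem iota_mem_valAt {P : MSpec (integralClosure o L)} {t : RTilde} (ht : t ∈ valAt o K P) :
    t.iota ∈ valAt o K P := by
  obtain ⟨⟨x, hx⟩, h0⟩ := ht
  exact ⟨⟨x⁻¹, by simp [hx, ord_inv]⟩, h0⟩

theorem iota_mem_vTildeAt {P : MSpec (integralClosure o L)} {t : RTilde}
    (ht : t ∈ vTildeAt o K P) : t.iota ∈ vTildeAt o K P :=
  ht.imp (iota_mem_valAt K) id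

variable [Algebra o K] [IsDedekindDomain o] [IsFractionRing o K] [IsScalarTower o K L]
  [Algebra.IsAlgebraic K L] (ho : ¬ IsField o)
include ho

theorem bddBelow_ord (I : FracIdeals o L) (P : MSpec (integralClosure o L)) :
    BddBelow {r : ℝ | ∃ x : Lˣ, (x : L) ∈ (I : FractionalIdeal (integralClosure o L)⁰ L) ∧
      (ord o K P x : ℝ) = r} := by
  obtain ⟨d, hd⟩ := exists_unit_mul_mem I
  refine ⟨-(ord o K P d : ℝ), ?_⟩
  rintro _ ⟨x, hx, rfl⟩
  have := ord_nonneg_of_mem K ho P (d * x) (hd x hx)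
  rw [ord_mul] at this
  have h : (0 : ℝ) ≤ (ord o K P d + ord o K P x : ℚ) := by exact_mod_cast this
  push_cast at h
  linarith

/-- The second component of `fTilde` records precisely what is needed to make it a greatest lower
bound in the ordered set `ℝ × {0, 1}`. -/
theorem isGLB_fTilde (I : FracIdeals o L) (P : MSpec (integralClosure o L)) :
    IsGLB (ordSet K I P) (fTilde o K I P) := by
  have hb := bddBelow_ord K ho I P
  obtain ⟨x₀, hx₀⟩ := exists_unit_mem I
  have hle : ∀ x : Lˣ, (x : L) ∈ (I : FractionalIdeal (integralClosure o L)⁰ L) →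
      fReal o K I P ≤ ord o K P x := fun x hx => csInf_le hb ⟨x, hx, rfl⟩
  constructor
  · rintro _ ⟨⟨x, hx⟩, rfl⟩
    rcases (hle x hx).lt_or_eq with h | h
    · exact RTilde.le_iff.2 (Or.inl h)
    · refine RTilde.le_iff.2 (Or.inr ⟨h, ?_⟩)
      rw [fTilde, if_pos ⟨x, hx, h.symm⟩]
  · intro c hc
    have hc' : ∀ x : Lˣ, (x : L) ∈ (I : FractionalIdeal (integralClosure o L)⁰ L) →
      c ≤ ⟨ord o K P x, 0⟩ := fun x hx => hc ⟨⟨x, hx⟩, rfl⟩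
    by_cases h : ∃ x : Lˣ, (x : L) ∈ (I : FractionalIdeal (integralClosure o L)⁰ L) ∧
        (ord o K P x : ℝ) = fReal o K I P
    · obtain ⟨x, hx, e⟩ := id h
      rw [fTilde, if_pos h, ← e]
      exact hc' x hx
    · rw [fTilde, if_neg h]
      have : c.re ≤ fReal o K I P := by
        refine le_csInf ⟨_, x₀, hx₀, rfl⟩ ?_
        rintro _ ⟨x, hx, rfl⟩
        rcases RTilde.le_iff.1 (hc' x hx) with h | h
        · exact h.le
        · exact h.1.le
      rcases this.lt_or_eq with h | h
      · exact RTilde.le_iff.2 (Or.inl h)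
      · exact RTilde.le_iff.2 (Or.inr ⟨h, Fin.le_last _⟩)

theorem fTilde_le (I : FracIdeals o L) (P : MSpec (integralClosure o L)) {x : Lˣ}
    (hx : (x : L) ∈ (I : FractionalIdeal (integralClosure o L)⁰ L)) :
    fTilde o K I P ≤ ⟨ord o K P x, 0⟩ :=
  (isGLB_fTilde K ho I P).1 ⟨⟨x, hx⟩, rfl⟩

theorem exists_mem_ord_lt {I : FracIdeals o L} {P : MSpec (integralClosure o L)} {c : RTilde}
    (h : fTilde o K I P < c) : ∃ x : Lˣ,
      (x : L) ∈ (I : FractionalIdeal (integralClosure o L)⁰ L) ∧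
        (⟨ord o K P x, 0⟩ : RTilde) < c := by
  obtain ⟨_, ⟨⟨x, hx⟩, rfl⟩, h⟩ := (isGLB_lt_iff (isGLB_fTilde K ho I P)).1 h
  exact ⟨x, hx, h⟩

theorem mem_iff_forall_fTilde_le (I : FracIdeals o L) (x : Lˣ) :
    (x : L) ∈ (I : FractionalIdeal (integralClosure o L)⁰ L) ↔
      ∀ P, fTilde o K I P ≤ ⟨ord o K P x, 0⟩ := by
  refine ⟨fun hx P => fTilde_le K ho I P hx, fun h => ?_⟩
  refine mem_of_forall_ord_le K ho
    ((I : FractionalIdeal (integralClosure o L)⁰ L) : Submodule (integralClosure o L) L) x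
    fun P => ?_
  obtain ⟨y, hy, hlt⟩ := exists_mem_ord_lt K ho (RTilde.le_mk_zero_iff.1 (h P))
  rw [← RTilde.le_mk_zero_iff, RTilde.mk_zero_le_mk_zero_iff] at hlt
  exact ⟨y, hy, by exact_mod_cast hlt⟩

theorem fTilde_injective : Function.Injective (fTilde o K : FracIdeals o L → _) := by
  intro I J h
  refine Subtype.ext (FractionalIdeal.ext fun x => ?_)
  by_cases hx : x = 0
  · rw [hx]
    exact ⟨fun _ => FractionalIdeal.zero_mem _, fun _ => FractionalIdeal.zero_mem _⟩
  · have := mem_iff_forall_fTilde_le K ho I (Units.mk0 x hx)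
    rw [h, ← mem_iff_forall_fTilde_le K ho J (Units.mk0 x hx)] at this
    exact this

theorem fTilde_mul (I J : FracIdeals o L) :
    fTilde o K (I * J) = fTilde o K I + fTilde o K J := by
  funext P
  have h := RTilde.isGLB_add (isGLB_fTilde K ho I P) (isGLB_fTilde K ho J P)
  refine (isGLB_fTilde K ho (I * J) P).unique ⟨?_, fun c hc => h.2 ?_⟩
  · rintro _ ⟨⟨z, hz⟩, rfl⟩
    change (z : L) ∈ (I : FractionalIdeal (integralClosure o L)⁰ L) * J at hz
    have key : ∀ z : L, z ∈ (I : FractionalIdeal (integralClosure o L)⁰ L) * J →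
        ∀ u : Lˣ, (u : L) = z → fTilde o K I P + fTilde o K J P ≤ ⟨ord o K P u, 0⟩ := by
      intro z hz
      refine FractionalIdeal.mul_induction_on hz ?_ ?_
      · intro x hx y hy u hu
        have hx0 : x ≠ 0 := fun h0 => u.ne_zero (by rw [hu, h0, zero_mul])
        have hy0 : y ≠ 0 := fun h0 => u.ne_zero (by rw [hu, h0, mul_zero])
        have : u = Units.mk0 x hx0 * Units.mk0 y hy0 := Units.ext hu
        rw [this, ord_mul, Rat.cast_add]
        exact RTilde.add_le_add (fTilde_le K ho I P hx) (fTilde_le K ho J P hy)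
      · intro x y hx hy u hu
        by_cases hx0 : x = 0
        · exact hy u (by rw [hu, hx0, zero_add])
        by_cases hy0 : y = 0
        · exact hx u (by rw [hu, hy0, add_zero])
        have hm := min_ord_le_ord_add K P (Units.mk0 x hx0) (Units.mk0 y hy0) u hu
        rcases min_le_iff.1 hm with h | h
        · refine (hx (Units.mk0 x hx0) rfl).trans (RTilde.mk_zero_le_mk_zero_iff.2 ?_)
          exact_mod_cast h
        · refine (hy (Units.mk0 y hy0) rfl).trans (RTilde.mk_zero_le_mk_zero_iff.2 ?_)
          exact_mod_cast h
    exact key z hz z rfl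
  · rintro _ ⟨⟨⟨x, hx⟩, ⟨y, hy⟩⟩, rfl⟩
    have := hc ⟨⟨x * y, FractionalIdeal.mul_mem_mul hx hy⟩, rfl⟩
    simpa only [ord_mul, Rat.cast_add] using this

theorem fTilde_one : fTilde o K (1 : FracIdeals o L) = 0 := by
  have hmem : ∀ x : Lˣ, (x : L) ∈ ((1 : FracIdeals o L) : FractionalIdeal (integralClosure o L)⁰ L)
      ↔ (x : L) ∈ integralClosure o L := by
    intro x
    refine (FractionalIdeal.mem_one_iff _).trans ⟨?_, fun h => ⟨⟨x, h⟩, rfl⟩⟩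
    rintro ⟨a, ha⟩
    rw [← ha]
    exact a.2
  funext P
  refine (isGLB_fTilde K ho 1 P).unique ⟨?_, fun c hc => ?_⟩
  · rintro _ ⟨⟨x, hx⟩, rfl⟩
    refine RTilde.mk_zero_le_mk_zero_iff.2 ?_
    exact_mod_cast ord_nonneg_of_mem K ho P x ((hmem x).1 hx)
  · have := hc ⟨⟨1, (hmem 1).2 (one_mem (integralClosure o L))⟩, rfl⟩
    simp only [ord_one, Rat.cast_zero] at this
    exact this

theorem fTilde_mem_vTildeAt (I : FracIdeals o L) (P : MSpec (integralClosure o L)) :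
    fTilde o K I P ∈ vTildeAt o K P := by
  by_cases h : ∃ x : Lˣ, (x : L) ∈ (I : FractionalIdeal (integralClosure o L)⁰ L) ∧
      (ord o K P x : ℝ) = fReal o K I P
  · obtain ⟨x, hx, e⟩ := id h
    rw [fTilde, if_pos h]
    exact Or.inl ⟨⟨x, e.symm⟩, rfl⟩
  · rw [fTilde, if_neg h]
    refine Or.inr ⟨(valClosure_eq_univ_iff K P).2 ?_, rfl⟩
    have hb := bddBelow_ord K ho I P
    have hne : {r : ℝ | ∃ x : Lˣ, (x : L) ∈ (I : FractionalIdeal (integralClosure o L)⁰ L) ∧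
        (ord o K P x : ℝ) = r}.Nonempty := by
      obtain ⟨x, hx⟩ := exists_unit_mem I
      exact ⟨_, x, hx, rfl⟩
    -- values arbitrarily close to an infimum which is not attained differ arbitrarily little
    have hex : ∀ r, fReal o K I P < r → ∃ x : Lˣ, fReal o K I P < ord o K P x ∧
        (ord o K P x : ℝ) < r := by
      intro r hr
      obtain ⟨_, ⟨x, hx, rfl⟩, hlt⟩ := exists_lt_of_csInf_lt hne hr
      exact ⟨x, lt_of_le_of_ne (csInf_le hb ⟨x, hx, rfl⟩) fun e => h ⟨x, hx, e.symm⟩, hlt⟩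
    refine AddSubgroup.dense_of_not_isolated_zero _ fun ε hε => ?_
    obtain ⟨x, hx, hx'⟩ := hex (fReal o K I P + ε) (by linarith)
    obtain ⟨y, hy, hy'⟩ := hex _ hx
    refine ⟨ord o K P x - ord o K P y, sub_mem ⟨x, rfl⟩ ⟨y, rfl⟩, ?_, ?_⟩ <;> linarith

theorem upperSemicontinuous_fTilde (I : FracIdeals o L) : UpperSemicontinuous (fTilde o K I) := by
  intro P c hc
  obtain ⟨x, hx, hlt⟩ := exists_mem_ord_lt K ho hc
  filter_upwards [(IsLocallyConstant.iff_eventually_eq _).1 (isLocallyConstant_ord K ho x) P]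
    with Q hQ
  refine (fTilde_le K ho I Q hx).trans_lt ?_
  rwa [hQ]

theorem fTilde_mem_bddV (I : FracIdeals o L) : fTilde o K I ∈ bddV o K L := by
  obtain ⟨x, hx⟩ := exists_unit_mem I
  obtain ⟨d, hd⟩ := exists_unit_mul_mem I
  have hdI : ∀ P, (⟨-ord o K P d, 0⟩ : RTilde) ≤ fTilde o K I P := by
    refine fun P => (isGLB_fTilde K ho I P).2 ?_
    rintro _ ⟨⟨y, hy⟩, rfl⟩
    have h := ord_nonneg_of_mem K ho P (d * y) (hd y hy)
    rw [ord_mul] at h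
    refine RTilde.mk_zero_le_mk_zero_iff.2 ?_
    rw [← Rat.cast_neg]
    exact_mod_cast neg_le_iff_add_nonneg'.2 h
  refine ⟨⟨upperSemicontinuous_fTilde K ho I, ?_, ?_, ?_⟩, fTilde_mem_vTildeAt K ho I⟩
  · obtain ⟨a, ha, hax⟩ := exists_ord_eq_zero K ho x
    obtain ⟨b, hb, hbd⟩ := exists_ord_eq_zero K ho d
    refine ⟨_, (MSpec.isCompact_setOf_mem ha).union (MSpec.isCompact_setOf_mem hb),
      fun P hP => ?_⟩
    simp only [Set.mem_union, Set.mem_ofPred_eq, not_or] at hP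
    have h1 := fTilde_le K ho I P hx
    have h2 := hdI P
    rw [hax P hP.1, Rat.cast_zero] at h1
    rw [hbd P hP.2, Rat.cast_zero, neg_zero] at h2
    exact le_antisymm h1 h2
  · obtain ⟨N, hN⟩ := exists_abs_ord_le K ho d
    refine ⟨⟨-N, 0⟩, fun P => (RTilde.mk_zero_le_mk_zero_iff.2 ?_).trans (hdI P)⟩
    exact_mod_cast neg_le_neg (abs_le.1 (hN P)).2
  · obtain ⟨N, hN⟩ := exists_abs_ord_le K ho x
    refine ⟨⟨N, 0⟩, fun P => (fTilde_le K ho I P hx).trans (RTilde.mk_zero_le_mk_zero_iff.2 ?_)⟩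
    exact_mod_cast (abs_le.1 (hN P)).2

/-! ### The ideal with prescribed valuations -/

/-- Any value above `f P` is taken at `P` by some `x` whose valuation is above `f` everywhere.
Starting from `x₀` with the right value at `P`, the condition holds near `P`, and outside a compact
set; it is enforced on the remaining compact set by multiplying with a high power of some `y` which
lies in all maximal ideals of this set but not in `P`. -/
theorem exists_ord_eq_and_le {f : MSpec (integralClosure o L) → RTilde}
    (hf : f ∈ bddUSC (MSpec (integralClosure o L))) {P : MSpec (integralClosure o L)} {x₀ : Lˣ}
    (h₀ : f P ≤ ⟨ord o K P x₀, 0⟩) :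
    ∃ x : Lˣ, ord o K P x = ord o K P x₀ ∧ ∀ Q, f Q ≤ ⟨ord o K Q x, 0⟩ := by
  obtain ⟨husc, ⟨C, hC, hfC⟩, -, ⟨b, hb⟩⟩ := hf
  obtain ⟨a, ha, hax⟩ := exists_ord_eq_zero K ho x₀
  obtain ⟨N, hN⟩ := exists_abs_ord_le K ho x₀
  have hU : ∀ᶠ Q in 𝓝 P, f Q ≤ ⟨ord o K Q x₀, 0⟩ := by
    filter_upwards [husc P _ (RTilde.le_mk_zero_iff.1 h₀),
      (IsLocallyConstant.iff_eventually_eq _).1 (isLocallyConstant_ord K ho x₀) P] with Q hQ hQ'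
    rwa [hQ', RTilde.le_mk_zero_iff]
  obtain ⟨U, hUf, hUo, hPU⟩ := eventually_nhds_iff.1 hU
  have hD : IsCompact ((C ∪ {Q | a ∈ Q.asIdeal}) \ U) :=
    (hC.union (MSpec.isCompact_setOf_mem ha)).diff hUo
  obtain ⟨y, hyP, hyD⟩ := MSpec.exists_notMem_of_isCompact hD (P := P) (fun h => h.2 hPU)
  have hy0 : (y : L) ≠ 0 := fun h => hyP (by
    rw [show y = 0 from Subtype.ext h]; exact zero_mem _)
  obtain ⟨M, hM⟩ := exists_le_ord_pow K ho (Units.mk0 _ hy0) hD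
    (fun Q hQ => (ord_pos_iff K ho Q _ y rfl).2 (hyD Q hQ)) (b.re + 1 + N)
  have hpow : ∀ Q, 0 ≤ ord o K Q (Units.mk0 _ hy0 ^ M) := fun Q =>
    ord_nonneg_of_mem K ho Q _ (by
      rw [Units.val_pow_eq_pow_val]
      exact pow_mem y.2 M)
  refine ⟨x₀ * Units.mk0 _ hy0 ^ M, ?_, fun Q => ?_⟩
  · rw [ord_mul, ord_pow, ord_eq_zero_of_notMem K ho P (Units.mk0 _ hy0) y rfl hyP, mul_zero,
      add_zero]
  · have hle : (⟨ord o K Q x₀, 0⟩ : RTilde) ≤ ⟨ord o K Q (x₀ * Units.mk0 _ hy0 ^ M), 0⟩ := by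
      refine RTilde.mk_zero_le_mk_zero_iff.2 ?_
      rw [ord_mul]
      exact_mod_cast le_add_of_nonneg_right (hpow Q)
    by_cases hQU : Q ∈ U
    · exact (hUf Q hQU).trans hle
    by_cases hQ : Q ∈ C ∪ {Q | a ∈ Q.asIdeal}
    · have h1 := hM Q ⟨hQ, hQU⟩
      have h2 : (-N : ℝ) ≤ ord o K Q x₀ := by exact_mod_cast (abs_le.1 (hN Q)).1
      refine (hb Q).trans (RTilde.le_iff.2 (Or.inl ?_))
      rw [ord_mul, Rat.cast_add]
      dsimp only
      linarith
    · rw [Set.mem_union, not_or] at hQ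
      refine le_trans (le_of_eq ?_) hle
      rw [hfC Q hQ.1, hax Q hQ.2, Rat.cast_zero]
      rfl

theorem exists_forall_ord_le {f : MSpec (integralClosure o L) → RTilde}
    (hf : f ∈ bddUSC (MSpec (integralClosure o L))) :
    ∃ d : Lˣ, (d : L) ∈ integralClosure o L ∧ ∀ P, (⟨-ord o K P d, 0⟩ : RTilde) ≤ f P := by
  obtain ⟨-, ⟨C, hC, hfC⟩, ⟨b, hb⟩, -⟩ := hf
  obtain ⟨a, ha, haC⟩ := MSpec.exists_mem_of_isCompact
    (not_isField_integralClosure (injective_algebraMap_of_isScalarTower K) ho) hC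
  have ha0 : (a : L) ≠ 0 := fun h => ha (Subtype.ext h)
  obtain ⟨M, hM⟩ := exists_le_ord_pow K ho (Units.mk0 _ ha0) hC
    (fun Q hQ => (ord_pos_iff K ho Q _ a rfl).2 (haC Q hQ)) (1 - b.re)
  have hmem : ((Units.mk0 (a : L) ha0 ^ M : Lˣ) : L) ∈ integralClosure o L := by
    rw [Units.val_pow_eq_pow_val]
    exact pow_mem a.2 M
  refine ⟨Units.mk0 _ ha0 ^ M, hmem, fun P => ?_⟩
  by_cases hP : P ∈ C
  · refine le_trans (RTilde.le_iff.2 (Or.inl ?_)) (hb P)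
    have := hM P hP
    dsimp only
    linarith
  · rw [hfC P hP]
    refine RTilde.mk_zero_le_mk_zero_iff.2 (neg_nonpos.2 ?_)
    exact_mod_cast ord_nonneg_of_mem K ho P _ hmem

/-- The inverse of `fTilde` sends `f` to the ideal of all `x` such that `(v_P(x), 0) ≥ f(P)` for
all `P`. -/
theorem exists_fTilde_eq {f : MSpec (integralClosure o L) → RTilde} (hf : f ∈ bddV o K L) :
    ∃ I : FracIdeals o L, fTilde o K I = f := by
  let M : Submodule (integralClosure o L) L :=
    { carrier := {x | ∀ u : Lˣ, (u : L) = x → ∀ P, f P ≤ ⟨ord o K P u, 0⟩}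
      zero_mem' := fun u hu => absurd hu u.ne_zero
      add_mem' := by
        intro x y hx hy u hu P
        by_cases hx0 : x = 0
        · exact hy u (by rw [hu, hx0, zero_add]) P
        by_cases hy0 : y = 0
        · exact hx u (by rw [hu, hy0, add_zero]) P
        have hm := min_ord_le_ord_add K P (Units.mk0 x hx0) (Units.mk0 y hy0) u hu
        rcases min_le_iff.1 hm with h | h
        · refine (hx (Units.mk0 x hx0) rfl P).trans (RTilde.mk_zero_le_mk_zero_iff.2 ?_)
          exact_mod_cast h
        · refine (hy (Units.mk0 y hy0) rfl P).trans (RTilde.mk_zero_le_mk_zero_iff.2 ?_)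
          exact_mod_cast h
      smul_mem' := by
        intro a x hx u hu P
        change (u : L) = (a : L) * x at hu
        have ha0 : (a : L) ≠ 0 := fun h0 => u.ne_zero (by rw [hu, h0, zero_mul])
        have hx0 : x ≠ 0 := fun h0 => u.ne_zero (by rw [hu, h0, mul_zero])
        have e : u = Units.mk0 _ ha0 * Units.mk0 x hx0 := Units.ext hu
        refine (hx (Units.mk0 x hx0) rfl P).trans (RTilde.mk_zero_le_mk_zero_iff.2 ?_)
        rw [e, ord_mul]
        exact_mod_cast le_add_of_nonneg_left (ord_nonneg_of_mem K ho P (Units.mk0 _ ha0) a.2) }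
  have hM : ∀ u : Lˣ, (u : L) ∈ M ↔ ∀ P, f P ≤ ⟨ord o K P u, 0⟩ := fun u =>
    ⟨fun h => h u rfl, fun h v hv => Units.ext hv ▸ h⟩
  have hfrac : IsFractional (integralClosure o L)⁰ M := by
    obtain ⟨d, hdO, hd⟩ := exists_forall_ord_le K ho hf.1
    refine ⟨⟨d, hdO⟩, mem_nonZeroDivisors_of_ne_zero
      fun h => d.ne_zero (congrArg Subtype.val h), fun x hx => ?_⟩
    by_cases hx0 : x = 0
    · exact ⟨0, by simp [hx0]⟩
    suffices h : ((d * Units.mk0 x hx0 : Lˣ) : L) ∈ integralClosure o L from ⟨⟨_, h⟩, rfl⟩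
    refine mem_integralClosure_of_forall_ord_nonneg K ho _ fun P => ?_
    have h := (hd P).trans (hx (Units.mk0 x hx0) rfl P)
    rw [RTilde.mk_zero_le_mk_zero_iff, neg_le_iff_add_nonneg'] at h
    rw [ord_mul]
    exact_mod_cast h
  let J : FractionalIdeal (integralClosure o L)⁰ L := ⟨M, hfrac⟩
  have hJ : ∀ u : Lˣ, (u : L) ∈ J ↔ ∀ P, f P ≤ ⟨ord o K P u, 0⟩ := hM
  have key : ∀ P b, f P < b → ∃ x : Lˣ, (x : L) ∈ J ∧ (⟨ord o K P x, 0⟩ : RTilde) < b := by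
    intro P b hb
    obtain ⟨x₀, h₀, hlt⟩ := exists_ord_of_mem_vTildeAt K (hf.2 P) hb
    obtain ⟨x, hx, h⟩ := exists_ord_eq_and_le K ho hf.1 h₀
    exact ⟨x, (hJ x).2 h, by rwa [hx]⟩
  have hJ0 : J ≠ 0 := by
    intro h0
    obtain ⟨m, hm⟩ := Ideal.exists_maximal (integralClosure o L)
    obtain ⟨P, -⟩ := MSpec.exists_asIdeal_eq hm
    obtain ⟨x, hx, -⟩ := key P ⟨(f P).re + 1, 0⟩ (RTilde.lt_mk_zero_iff.2 (by linarith))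
    rw [h0, FractionalIdeal.mem_zero_iff] at hx
    exact x.ne_zero hx
  refine ⟨⟨J, hJ0⟩, funext fun P => (isGLB_fTilde K ho _ P).unique ⟨?_, fun c hc => ?_⟩⟩
  · rintro _ ⟨⟨x, hx⟩, rfl⟩
    exact (hJ x).1 hx P
  · by_contra! hlt
    obtain ⟨x, hx, h⟩ := key P c hlt
    exact (hc ⟨⟨x, hx⟩, rfl⟩ : c ≤ _).not_gt h

end FTildeMap

/-! ### Quotient monoids -/

section Quotients

@[to_additive]
theorem Submonoid.modCon_mk'_eq_iff {M : Type*} [CommMonoid M] (N : Submonoid M) {a b : M} :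
    N.modCon.mk' a = N.modCon.mk' b ↔ ∃ m ∈ N, ∃ n ∈ N, m * a = n * b :=
  N.modCon.eq

/-- The third isomorphism theorem, on the level of congruences. -/
theorem Submonoid.modCon_map_modCon_mk'_eq_iff {M : Type*} [CommMonoid M] {N N' : Submonoid M}
    (h : N ≤ N') {a b : M} :
    (N'.map N.modCon.mk').modCon.mk' (N.modCon.mk' a) =
      (N'.map N.modCon.mk').modCon.mk' (N.modCon.mk' b) ↔ N'.modCon.mk' a = N'.modCon.mk' b := by
  rw [modCon_mk'_eq_iff, modCon_mk'_eq_iff]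
  constructor
  · rintro ⟨_, ⟨m, hm, rfl⟩, _, ⟨n, hn, rfl⟩, e⟩
    rw [← map_mul, ← map_mul, modCon_mk'_eq_iff] at e
    obtain ⟨p, hp, q, hq, e⟩ := e
    exact ⟨p * m, N'.mul_mem (h hp) hm, q * n, N'.mul_mem (h hq) hn,
      by rw [mul_assoc, e, mul_assoc]⟩
  · rintro ⟨m, hm, n, hn, e⟩
    exact ⟨_, ⟨m, hm, rfl⟩, _, ⟨n, hn, rfl⟩, by rw [← map_mul, ← map_mul, e]⟩

/-- If the elements of `N` are units, then a class modulo `N` is regular if and only if its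
representatives are. -/
theorem Submonoid.mk'_mem_vonNeumannRegular_iff {M : Type*} [CommMonoid M] {N : Submonoid M}
    (hN : ∀ p ∈ N, ∃ q : M, p * q = 1) (a : M) :
    N.modCon.mk' a ∈ vonNeumannRegular N.modCon.Quotient ↔ a ∈ vonNeumannRegular M := by
  constructor
  · rintro ⟨b, hb⟩
    obtain ⟨b, rfl⟩ := Con.mk'_surjective b
    rw [← map_mul, ← map_mul, modCon_mk'_eq_iff] at hb
    obtain ⟨p, hp, q, -, e⟩ := hb
    obtain ⟨p', hp'⟩ := hN p hp
    refine ⟨p' * q * b, ?_⟩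
    calc a = p' * (p * a) := by rw [← mul_assoc, mul_comm p', hp', one_mul]
      _ = a * (p' * q * b) * a := by rw [e]; ac_rfl
  · rintro ⟨b, hb⟩
    exact ⟨N.modCon.mk' b, by rw [← map_mul, ← map_mul, ← hb]⟩

variable {M A : Type*} [CommMonoid M] [AddCommMonoid A] (e : M ≃* Multiplicative A)

theorem MulEquiv.exists_mul_eq_one_iff (a : M) :
    (∃ b, a * b = 1) ↔ ∃ b : A, (e a).toAdd + b = 0 := by
  constructor
  · rintro ⟨b, hb⟩
    exact ⟨(e b).toAdd, by rw [← toAdd_mul, ← map_mul, hb, map_one, toAdd_one]⟩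
  · rintro ⟨b, hb⟩
    refine ⟨e.symm (Multiplicative.ofAdd b), e.injective ?_⟩
    rw [map_mul, apply_symm_apply, map_one]
    exact congrArg Multiplicative.ofAdd hb

theorem MulEquiv.mem_vonNeumannRegular_iff (a : M) :
    a ∈ vonNeumannRegular M ↔ ∃ b : A, (e a).toAdd = (e a).toAdd + b + (e a).toAdd := by
  constructor
  · rintro ⟨b, hb⟩
    exact ⟨(e b).toAdd, by rw [← toAdd_mul, ← toAdd_mul, ← map_mul, ← map_mul, ← hb]⟩
  · rintro ⟨b, hb⟩
    refine ⟨e.symm (Multiplicative.ofAdd b), e.injective ?_⟩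
    rw [map_mul, map_mul, apply_symm_apply]
    exact congrArg Multiplicative.ofAdd hb

/-- An isomorphism `M ≃ A` which identifies a submonoid `N` of `M` with a submonoid `B` of `A`
induces an isomorphism between the iterated quotient `(M / P) / (N / P)`, for `P ≤ N`, and
`A / B`. -/
theorem MulEquiv.exists_quotient_mulEquiv {P N : Submonoid M} (hPN : P ≤ N) {B : AddSubmonoid A}
    (hB : ∀ a, a ∈ N ↔ (e a).toAdd ∈ B) :
    ∃ Φ : (N.map P.modCon.mk').modCon.Quotient ≃* Multiplicative B.modCon.Quotient,
      ∀ a, Φ ((N.map P.modCon.mk').modCon.mk' (P.modCon.mk' a)) =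
        Multiplicative.ofAdd (B.modCon.mk' (e a).toAdd) := by
  let ψ : M →* (N.map P.modCon.mk').modCon.Quotient :=
    (N.map P.modCon.mk').modCon.mk'.comp P.modCon.mk'
  let φ : M →* Multiplicative B.modCon.Quotient :=
    (AddMonoidHom.toMultiplicative B.modCon.mk').comp e.toMonoidHom
  have hψ : Function.Surjective ψ := Con.mk'_surjective.comp Con.mk'_surjective
  have hφ : Function.Surjective φ := fun c => by
    obtain ⟨f, hf⟩ := AddCon.mk'_surjective (c := B.modCon) c.toAdd
    obtain ⟨a, ha⟩ := e.surjective (Multiplicative.ofAdd f)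
    refine ⟨a, ?_⟩
    change Multiplicative.ofAdd (B.modCon.mk' (e a).toAdd) = c
    rw [ha]
    exact congrArg Multiplicative.ofAdd hf
  have hker : Con.ker ψ = Con.ker φ := Con.ext fun a b => by
    change ψ a = ψ b ↔ B.modCon.mk' (e a).toAdd = B.modCon.mk' (e b).toAdd
    refine (Submonoid.modCon_map_modCon_mk'_eq_iff hPN).trans ?_
    rw [Submonoid.modCon_mk'_eq_iff, AddSubmonoid.modCon_mk'_eq_iff]
    constructor
    · rintro ⟨m, hm, n, hn, h⟩
      exact ⟨_, (hB m).1 hm, _, (hB n).1 hn,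
        by rw [← toAdd_mul, ← toAdd_mul, ← map_mul, ← map_mul, h]⟩
    · rintro ⟨f, hf, g, hg, h⟩
      obtain ⟨m, hm⟩ := e.surjective (Multiplicative.ofAdd f)
      obtain ⟨n, hn⟩ := e.surjective (Multiplicative.ofAdd g)
      refine ⟨m, (hB m).2 (by rwa [hm]), n, (hB n).2 (by rwa [hn]), e.injective ?_⟩
      rw [map_mul, map_mul, hm, hn]
      exact congrArg Multiplicative.ofAdd h
  refine ⟨(Con.quotientKerEquivOfSurjective ψ hψ).symm.trans
    ((Con.congr (MulEquiv.refl _) hker).trans (Con.quotientKerEquivOfSurjective φ hφ)),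
    fun a => ?_⟩
  have : (Con.quotientKerEquivOfSurjective ψ hψ).symm (ψ a) = (Con.ker ψ).mk' a :=
    (MulEquiv.symm_apply_eq _).2 rfl
  change ((Con.congr (MulEquiv.refl _) hker).trans (Con.quotientKerEquivOfSurjective φ hφ))
    ((Con.quotientKerEquivOfSurjective ψ hψ).symm (ψ a)) = _
  rw [this]
  rfl

end Quotients

section IdealClasses

open nonZeroDivisors

theorem principalIdeals_le_invertibleIdeals (o L : Type*) [CommRing o] [Field L] [Algebra o L]
    [IsFractionRing (integralClosure o L) L] : principalIdeals o L ≤ invertibleIdeals o L := by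
  rintro I ⟨a, ha⟩
  have hI : (I : FractionalIdeal (integralClosure o L)⁰ L) =
      FractionalIdeal.spanSingleton _ (a : L) :=
    FractionalIdeal.coeToSubmodule_injective
      (ha.trans (FractionalIdeal.coe_spanSingleton _ _).symm)
  refine ⟨⟨FractionalIdeal.spanSingleton _ ((a⁻¹ : Lˣ) : L),
    FractionalIdeal.spanSingleton_ne_zero_iff.2 (a⁻¹).ne_zero⟩, Subtype.ext ?_⟩
  change (I : FractionalIdeal (integralClosure o L)⁰ L) * _ = 1
  rw [hI, FractionalIdeal.spanSingleton_mul_spanSingleton, Units.mul_inv,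
    FractionalIdeal.spanSingleton_one]

end IdealClasses

/-! ### Invertible and reflexible functions -/

section Isomorphism

variable {o : Type*} (K : Type*) {L : Type*} [CommRing o] [Field K] [Field L] [Algebra K L]
  [Algebra o L]

/-- The units of the monoid of functions are its reflexible elements with second component zero. -/
theorem mem_reflValIn_iff (f : bddV o K L) : f ∈ reflValIn o K L ↔ ∃ g : bddV o K L, f + g = 0 := by
  constructor
  · rintro ⟨hf, hval⟩
    refine ⟨⟨_, hf.2, fun P => Or.inl (iota_mem_valAt K (hval P))⟩,
      Subtype.ext (funext fun P => ?_)⟩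
    refine RTilde.ext (add_neg_cancel _) ?_
    change max (f.1 P).lvl (f.1 P).lvl = 0
    rw [max_self]
    exact (hval P).2
  · rintro ⟨g, hg⟩
    have hP : ∀ P, f.1 P + g.1 P = 0 := fun P => congrFun (congrArg Subtype.val hg) P
    have h0 : ∀ P, (f.1 P).lvl = 0 ∧ (g.1 P).lvl = 0 := fun P => by
      have := congrArg RTilde.lvl (hP P)
      rw [RTilde.add_lvl, RTilde.zero_lvl] at this
      constructor
      · exact le_antisymm (this ▸ le_max_left _ _) (Fin.zero_le _)
      · exact le_antisymm (this ▸ le_max_right _ _) (Fin.zero_le _)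
    have hi : RTilde.iota ∘ f.1 = g.1 := funext fun P => by
      refine RTilde.ext ?_ ((h0 P).1.trans (h0 P).2.symm)
      have := congrArg RTilde.re (hP P)
      rw [RTilde.add_re, RTilde.zero_re] at this
      exact neg_eq_of_add_eq_zero_right this
    refine ⟨⟨f.2.1, hi ▸ g.2.1⟩, fun P => (f.2.2 P).resolve_right fun h => ?_⟩
    rw [(h0 P).1] at h
    exact absurd h.2 (by decide)

/-- If `f = f + g + f`, then `ι ∘ f = f + g + g`. -/
theorem mem_reflVIn_iff (f : bddV o K L) :
    f ∈ reflVIn o K L ↔ ∃ g : bddV o K L, f = f + g + f := by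
  constructor
  · rintro ⟨hf, hval⟩
    refine ⟨⟨_, hf.2, fun P => iota_mem_vTildeAt K (hval P)⟩, Subtype.ext (funext fun P => ?_)⟩
    refine RTilde.ext ?_ ?_
    · change (f.1 P).re = (f.1 P).re + -(f.1 P).re + (f.1 P).re
      ring
    · change (f.1 P).lvl = max (max (f.1 P).lvl (f.1 P).lvl) (f.1 P).lvl
      rw [max_self, max_self]
  · rintro ⟨g, hg⟩
    have hP : ∀ P, f.1 P = f.1 P + g.1 P + f.1 P := fun P => congrFun (congrArg Subtype.val hg) P
    have hi : RTilde.iota ∘ f.1 = (f + g + g).1 := funext fun P => by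
      have h1 := congrArg RTilde.re (hP P)
      have h2 := congrArg RTilde.lvl (hP P)
      simp only [RTilde.add_re, RTilde.add_lvl] at h1 h2
      refine RTilde.ext ?_ ?_
      · change -(f.1 P).re = (f.1 P).re + (g.1 P).re + (g.1 P).re
        linarith
      · change (f.1 P).lvl = max (max (f.1 P).lvl (g.1 P).lvl) (g.1 P).lvl
        rw [max_assoc, max_self]
        exact le_antisymm (le_max_left _ _) ((le_max_left _ _).trans h2.ge)
    exact ⟨⟨f.2.1, hi ▸ (f + g + g).2.1⟩, f.2.2⟩

variable (o L)
variable [Algebra o K] [IsDedekindDomain o] [IsFractionRing o K] [IsScalarTower o K L]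
  [Algebra.IsAlgebraic K L]

/-- The map `I ↦ fTilde I` is an isomorphism from the monoid of fractional ideals to the monoid of
functions. -/
noncomputable def fTildeEquiv (ho : ¬ IsField o) :
    FracIdeals o L ≃* Multiplicative (bddV o K L) :=
  MulEquiv.ofBijective
    ({ toFun := fun I => Multiplicative.ofAdd ⟨fTilde o K I, fTilde_mem_bddV K ho I⟩
       map_one' := congrArg Multiplicative.ofAdd (Subtype.ext (fTilde_one K ho))
       map_mul' := fun I J => congrArg Multiplicative.ofAdd (Subtype.ext (fTilde_mul K ho I J)) } :
      FracIdeals o L →* Multiplicative (bddV o K L))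
    ⟨fun _ _ h => fTilde_injective K ho (congrArg Subtype.val (Multiplicative.ofAdd.injective h)),
      fun f => by
        obtain ⟨I, hI⟩ := exists_fTilde_eq K ho f.toAdd.2
        exact ⟨I, congrArg Multiplicative.ofAdd (Subtype.ext hI)⟩⟩

end Isomorphism

theorem corollary2p6 (o K L : Type*) [CommRing o] [IsDedekindDomain o] (ho : ¬ IsField o)
    [Field K] [Algebra o K] [IsFractionRing o K]
    [Field L] [Algebra K L] [Algebra o L] [IsScalarTower o K L] [Algebra.IsAlgebraic K L] :
    ∃ F : FracIdeals o L →* Multiplicative (bddV o K L),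
      (∀ I, ((F I).toAdd : MSpec (integralClosure o L) → RTilde) = fTilde o K I) ∧
      ∃ Φ : ClassModPic o L ≃* Multiplicative (FunctionQuotient o K L),
        (∀ I, Φ (toClassModPic o L I) =
          Multiplicative.ofAdd (toFunctionQuotient o K L (F I).toAdd)) ∧
        (regClassModPic o L).map (Φ : ClassModPic o L →* Multiplicative (FunctionQuotient o K L)) =
          AddSubmonoid.toSubmonoid ((reflVIn o K L).map (toFunctionQuotient o K L)) := by
  have := isFractionRing_integralClosure (o := o) (L := L) K
  have hPI := principalIdeals_le_invertibleIdeals o L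
  set e := fTildeEquiv o K L ho
  obtain ⟨Φ, hΦ⟩ := e.exists_quotient_mulEquiv hPI (B := reflValIn o K L) fun I =>
    (e.exists_mul_eq_one_iff I).trans (mem_reflValIn_iff K _).symm
  have hreg : ∀ I, (principalIdeals o L).modCon.mk' I ∈
      vonNeumannRegular (IdealClassSemigroup o L) ↔ (e I).toAdd ∈ reflVIn o K L := fun I =>
    (Submonoid.mk'_mem_vonNeumannRegular_iff (fun _ h => hPI h) I).trans
      ((e.mem_vonNeumannRegular_iff I).trans (mem_reflVIn_iff K _).symm)
  refine ⟨e.toMonoidHom, fun I => rfl, Φ, hΦ, ?_⟩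
  ext c
  constructor
  · rintro ⟨_, ⟨a, ha, rfl⟩, rfl⟩
    obtain ⟨I, rfl⟩ := Con.mk'_surjective a
    exact ⟨_, (hreg I).1 ha, (congrArg Multiplicative.toAdd (hΦ I)).symm⟩
  · rintro ⟨f, hf, hfc⟩
    obtain ⟨I, hI⟩ := e.surjective (Multiplicative.ofAdd f)
    refine ⟨toClassModPic o L I, ⟨_, (hreg I).2 (by rw [hI]; exact hf), rfl⟩, ?_⟩
    refine (hΦ I).trans ?_
    rw [hI]
    exact congrArg Multiplicative.ofAdd hfc
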